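/- Consider the following dynamic matching model. An instance $\mathcal I=(\mathcal T,\lambda,\mu,r)$ consists of a finite set $\mathcal T$ of agent types, rates $\lambda_i,\mu_i>0$ for $i\in\mathcal T$, and rewards $r_{ij}\in\mathbb R$ for $i,j\in\mathcal T$. Agents of type $i$ arrive according to a Poisson process of rate $\lambda_i$, independently across types. Each agent $a$ of type $i$, arriving at time $t_a$, has an independent, exponentially distributed maximum sojourn time of rate $\mu_i$, after which, at time $d_a$, it departs if unmatched. Matching an agent of type $i$ with a later-arriving agent of type $j$ earns $r_{ij}$, and every agent is matched at most once. The instance has homogeneous departures if either all $\mu_i$ are equal, or $\mathcal T$ can be partitioned into $\mathcal T_1,\mathcal T_2$ such that, for $k=1,2$ and all $i,j\in\mathcal T_k$, $r_{ij}\le 0$ and $\mu_i=\mu_j$. Let $G(t)$ be the graph on the agents who arrive before time $t$ in which distinct agents $a,b$ are adjacent if $[t_a,d_a]\cap[t_b,d_b]\ne\emptyset$. Let $\mathrm{OFF}(\mathcal I,t)$ be $\frac1t$ times the largest expected total reward of a matching of $G(t)$ that is chosen with full knowledge of the types, arrival times and departure times $d_a$ of all these agents, and let $\mathrm{OFF}(\mathcal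 I)=\lim_{t\to\infty}\mathrm{OFF}(\mathcal I,t)$ (read as a $\liminf$). An online policy $\pi$ is a possibly randomized, non-anticipating rule which matches pairs of agents that are both present: decisions made by time $t$ depend only on the arrivals and departures observed up to time $t$ and on randomness independent of the arrivals and sojourn times. Let $N_i^\pi(t)$ be the number of agents of type $i$ who have arrived before $t$ and have been neither matched nor lost before $t$. The policy is Markovian if $N^\pi=(N_i^\pi)_{i\in\mathcal T}$ is a (time-homogeneous) continuous-time Markov chain. Let $V(\pi,\mathcal I)=\lim_{t\to\infty}\frac1t\,\mathbb E[\text{total reward of the matches made before time }t]$ (read as a $\limsup$). **Theorem.** For every $\varepsilon>0$ there is an instance $\mathcal I$ with homogeneous departures, which can be taken to have exactly two types with equal departure rates, such that for every Markovian online policy $\pi$, $$V(\pi,\mathcal I)<\left(\tfrac12+\varepsilon\right)\mathrm{OFF}(\mathcal I).$$ -/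

import Mathlib

open MeasureTheory ProbabilityTheory Filter

noncomputable section

/-- An instance of the matching problem with abandonment: a finite set `T` of agent types, arrival
rates `lam i`, abandonment rates `mu i`, and the reward `r i j` of matching an agent of type `i`
with a later-arriving agent of type `j`. -/
structure MatchingInstance where
  T : Type
  [fintypeT : Fintype T]
  lam : T → ℝ
  mu : T → ℝ
  r : T → T → ℝ
  lam_pos : ∀ i, 0 < lam i
  mu_pos : ∀ i, 0 < mu i

attribute [instance] MatchingInstance.fintypeT

namespace MatchingInstance

/-- Either all departure rates agree, or the types split into two classes such that no pair within
a class has a positive reward and departure rates agree within each class. -/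
def HomogeneousDepartures (I : MatchingInstance) : Prop :=
  (∀ i j, I.mu i = I.mu j) ∨
    ∃ S : Set I.T,
      (∀ i j, (i ∈ S ↔ j ∈ S) → I.r i j ≤ 0) ∧
      (∀ i j, (i ∈ S ↔ j ∈ S) → I.mu i = I.mu j)

/-- The agent `(i, k)` is the `k`-th arriving agent of type `i` (counting from `0`). -/
abbrev Agent (I : MatchingInstance) : Type := I.T × ℕ

/-- A realization of the primitive randomness: for the agent `(i, k)`, `(ω (i, k)).1` is the time
between the arrivals of the `(k-1)`-st and the `k`-th agents of type `i` (the time until the first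
arrival, for `k = 0`), and `(ω (i, k)).2` is the maximum sojourn time of the agent. -/
abbrev Path (I : MatchingInstance) : Type := I.Agent → ℝ × ℝ

instance (I : MatchingInstance) (a : I.Agent) : IsProbabilityMeasure (expMeasure (I.lam a.1)) :=
  isProbabilityMeasure_expMeasure (I.lam_pos a.1)

instance (I : MatchingInstance) (a : I.Agent) : IsProbabilityMeasure (expMeasure (I.mu a.1)) :=
  isProbabilityMeasure_expMeasure (I.mu_pos a.1)

/-- The law of the arrivals and maximum sojourn times: all the inter-arrival times and sojourn times
are independent, those of type `i` being exponential of rates `lam i` and `mu i` respectively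
(so the arrivals of the types are independent Poisson processes). -/
def law (I : MatchingInstance) : Measure I.Path :=
  Measure.infinitePi fun a : I.Agent => (expMeasure (I.lam a.1)).prod (expMeasure (I.mu a.1))

/-- The arrival time `t_a` of the agent `a`. -/
def arrival (I : MatchingInstance) (ω : I.Path) (a : I.Agent) : ℝ :=
  ∑ k ∈ Finset.range (a.2 + 1), (ω (a.1, k)).1

/-- The time `d_a = t_a + s_a` at which the agent `a` departs if unmatched. -/
def departure (I : MatchingInstance) (ω : I.Path) (a : I.Agent) : ℝ :=
  I.arrival ω a + (ω a).2

/-- The (almost sure) regularity properties of a realization: positive inter-arrival and sojourn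
times, and finitely many arrivals in every bounded period of time. -/
def Regular (I : MatchingInstance) (ω : I.Path) : Prop :=
  (∀ a, 0 < (ω a).1 ∧ 0 < (ω a).2) ∧
    ∀ i : I.T, Tendsto (fun k : ℕ => I.arrival ω (i, k)) atTop atTop

/-! ### The omniscient benchmark -/

/-- The edge relation of the graph `G(t)` on the agents who arrive before `t`: two distinct agents
are joined when their potential periods of presence intersect. -/
def Edge (I : MatchingInstance) (t : ℝ) (ω : I.Path) (a b : I.Agent) : Prop :=
  a ≠ b ∧ I.arrival ω a < t ∧ I.arrival ω b < t ∧
    (Set.Icc (I.arrival ω a) (I.departure ω a) ∩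
      Set.Icc (I.arrival ω b) (I.departure ω b)).Nonempty

/-- Two realizations have the same history `{(i_a, t_a, d_a)}` of the agents who arrive before `t`. -/
def SameHistory (I : MatchingInstance) (t : ℝ) (ω ω' : I.Path) : Prop :=
  ∀ a, (I.arrival ω a < t ∨ I.arrival ω' a < t) →
    I.arrival ω a = I.arrival ω' a ∧ I.departure ω a = I.departure ω' a

/-- A policy without informational constraints: for every horizon `t` it maps the history up to `t`
(including the future departure times of the agents in it) to a matching of the graph `G(t)`.
A matched pair is written with the earlier-arriving agent first. -/
structure OmnisPolicy (I : MatchingInstance) where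
  choose : ℝ → I.Path → Finset (I.Agent × I.Agent)
  edge : ∀ t ω, I.Regular ω → ∀ p ∈ choose t ω,
    I.Edge t ω p.1 p.2 ∧ I.arrival ω p.1 < I.arrival ω p.2
  matching : ∀ t ω, I.Regular ω → ∀ p ∈ choose t ω, ∀ q ∈ choose t ω, p ≠ q →
    p.1 ≠ q.1 ∧ p.1 ≠ q.2 ∧ p.2 ≠ q.1 ∧ p.2 ≠ q.2
  history : ∀ t ω ω', I.Regular ω → I.Regular ω' → I.SameHistory t ω ω' →
    choose t ω = choose t ω'
  measurable : ∀ t p, MeasurableSet {ω | p ∈ choose t ω}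

/-- The expected reward rate `V(π, I, t)` of a policy without informational constraints. -/
def OmnisPolicy.value {I : MatchingInstance} (π : I.OmnisPolicy) (t : ℝ) : ℝ :=
  (1 / t) * ∫ ω, ∑ p ∈ π.choose t ω, I.r p.1.1 p.2.1 ∂I.law

/-- The value `OFF(I, t)` of the optimal omniscient policy with horizon `t`. -/
def offValue (I : MatchingInstance) (t : ℝ) : ℝ :=
  ⨆ π : I.OmnisPolicy, π.value t

/-- The long-run omniscient reward rate `OFF(I)`, the limit of `OFF(I, t)` as `t → ∞`, taken as a
lower limit so that no question of convergence arises. -/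
def off (I : MatchingInstance) : ℝ :=
  liminf (fun t : ℝ => I.offValue t) atTop

/-! ### Online and Markovian policies -/

/-- Two realizations cannot be told apart by an observer at time `t`: the arrivals that occur no
later than `t` are the same in both, and so are the departure times that are no later than `t`. -/
def SameObservation (I : MatchingInstance) (t : ℝ) (ω ω' : I.Path) : Prop :=
  (∀ a, (I.arrival ω a ≤ t ∨ I.arrival ω' a ≤ t) → I.arrival ω a = I.arrival ω' a) ∧
  (∀ a, (I.departure ω a ≤ t ∨ I.departure ω' a ≤ t) → I.departure ω a = I.departure ω' a)

/-- An online (non-anticipating), possibly randomized policy. The randomization is an auxiliary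
random element `u` that is independent of the arrivals and sojourn times. The value
`matchTime u ω a b` is the time at which the agent `a` is matched with the later-arriving agent `b`,
and is `⊤` if these two are never matched with each other. -/
structure OnlinePolicy (I : MatchingInstance) where
  Seed : Type
  [measurableSpaceSeed : MeasurableSpace Seed]
  seedLaw : Measure Seed
  [isProbabilityMeasure : IsProbabilityMeasure seedLaw]
  matchTime : Seed → I.Path → I.Agent → I.Agent → EReal
  /-- A match is made when both agents have arrived and neither has departed. -/
  feasible : ∀ u ω, I.Regular ω → ∀ a b, matchTime u ω a b ≠ ⊤ →
    I.arrival ω a < I.arrival ω b ∧ (I.arrival ω b : EReal) ≤ matchTime u ω a b ∧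
      matchTime u ω a b < (I.departure ω a : EReal) ∧
      matchTime u ω a b < (I.departure ω b : EReal)
  /-- Every agent is matched at most once. -/
  matching : ∀ u ω, I.Regular ω → ∀ a b a' b', matchTime u ω a b ≠ ⊤ → matchTime u ω a' b' ≠ ⊤ →
    (a, b) ≠ (a', b') → a ≠ a' ∧ a ≠ b' ∧ b ≠ a' ∧ b ≠ b'
  /-- The matches made up to time `t` depend only on what is observed up to time `t`. -/
  nonanticipating : ∀ u (t : ℝ) ω ω', I.Regular ω → I.Regular ω' → I.SameObservation t ω ω' →
    ∀ a b, matchTime u ω a b ≤ (t : EReal) → matchTime u ω' a b = matchTime u ω a b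
  measurable : ∀ a b, Measurable fun p : Seed × I.Path => matchTime p.1 p.2 a b

attribute [instance] OnlinePolicy.measurableSpaceSeed OnlinePolicy.isProbabilityMeasure

namespace OnlinePolicy

variable {I : MatchingInstance} (π : I.OnlinePolicy)

/-- The joint law of the randomization of the policy and of the arrivals and sojourn times. -/
def jointLaw : Measure (π.Seed × I.Path) := π.seedLaw.prod I.law

open Classical in
/-- The total reward of the matches made before time `t`. -/
def totalReward (t : ℝ) (u : π.Seed) (ω : I.Path) : ℝ :=
  ∑' p : I.Agent × I.Agent, if π.matchTime u ω p.1 p.2 < (t : EReal) then I.r p.1.1 p.2.1 else 0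

/-- The expected reward rate `V(π, I, t)` up to time `t`. -/
def value (t : ℝ) : ℝ :=
  (1 / t) * ∫ x, π.totalReward t x.1 x.2 ∂π.jointLaw

/-- The long-run reward rate `V(π, I)`, the limit of `V(π, I, t)` as `t → ∞`, taken as an upper
limit so that no question of convergence arises. -/
def longRunValue : ℝ :=
  limsup (fun t : ℝ => π.value t) atTop

/-- The agent `a` is present at time `t`: it arrived before `t` and has been neither matched nor
lost before `t`. -/
def Present (t : ℝ) (u : π.Seed) (ω : I.Path) (a : I.Agent) : Prop :=
  I.arrival ω a < t ∧ t ≤ I.departure ω a ∧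
    ∀ b, (t : EReal) ≤ π.matchTime u ω a b ∧ (t : EReal) ≤ π.matchTime u ω b a

/-- The state `N(t)` of the system: the number of agents of each type that are present at `t`. -/
def state (t : ℝ) (x : π.Seed × I.Path) : I.T → ℕ :=
  fun i => Set.ncard {k : ℕ | π.Present t x.1 x.2 (i, k)}

/-- The policy is Markovian: the induced state process `N` is a (time-homogeneous) continuous-time
Markov chain, i.e. there are transition probabilities `P s n n'` such that, for all times
`0 ≤ τ 0 < ⋯ < τ (m + 1)`, given `N (τ 0) = n 0, …, N (τ m) = n m`, the state `N (τ (m + 1))` has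
distribution `P (τ (m + 1) - τ m) (n m)`. -/
def IsMarkovian : Prop :=
  ∃ P : ℝ → (I.T → ℕ) → PMF (I.T → ℕ),
    ∀ (m : ℕ) (τ : ℕ → ℝ) (n : ℕ → I.T → ℕ), 0 ≤ τ 0 → StrictMono τ →
      π.jointLaw {x | ∀ k ≤ m + 1, π.state (τ k) x = n k} =
        π.jointLaw {x | ∀ k ≤ m, π.state (τ k) x = n k} * P (τ (m + 1) - τ m) (n m) (n (m + 1))

end OnlinePolicy

end MatchingInstance

end

/-! The hard instance is `rareCommon d` with `d` small. A pair of rare agents is worth `1 / d`, but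
during the unit mean sojourn of one rare agent a second one arrives with probability only about `d`.
A waiting rare agent can almost always be matched with an abundant one, for a reward of `1`.

An online policy must choose. While a rare agent stays unmatched, the next rare arrival (rate `d`)
and its departure (rate `1`) compete, and non-anticipation keeps the policy from seeing which will
win. Waiting for a second rare agent is therefore worth at most `1 / d * d = 1`, no more than an
immediate match, and no online policy earns more than `1` per rare arrival: `longRunValue_le`,
resting on the balance `law_unmatched` and the pathwise inequality `tsum_reward_le`.

With departure times known there is no choice to make. The fraction of about `d` of the rare agents
who are still present at the next rare arrival form rare pairs, earning about `1` per rare arrival,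
and nearly all the others are matched with an abundant agent, earning about `1` more. This is
realized by the explicit rule `localPolicy`, with rate bounded below in `localRate_le_value`, so the
benchmark is at least `d * (2 - O(d))` against `d` online, and the ratio tends to `1 / 2`.

All probabilities are computed by resampling single inter-arrival or sojourn times
(`lintegral_setGap`, `lintegral_setSojourn`) and by exponential races. -/

open scoped ENNReal

noncomputable section

/-! ### Measurability of predicates that compare random variables -/

section MeasurableProp

variable {X β : Type*} [MeasurableSpace X] [TopologicalSpace β] [MeasurableSpace β]
  [OpensMeasurableSpace β] [LinearOrder β] [OrderClosedTopology β] [SecondCountableTopology β]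
  {f g : X → β}

@[fun_prop]
theorem Measurable.lt_prop (hf : Measurable f) (hg : Measurable g) :
    Measurable fun x => f x < g x :=
  measurableSet_setOfPred.1 (measurableSet_lt hf hg)

@[fun_prop]
theorem Measurable.le_prop (hf : Measurable f) (hg : Measurable g) :
    Measurable fun x => f x ≤ g x :=
  measurableSet_setOfPred.1 (measurableSet_le hf hg)

end MeasurableProp

/-! ### Exponential distributions -/

section Exponential

open Set

variable {a b r : ℝ}

theorem lintegral_expMeasure (r : ℝ) (hr : 0 < r) {f : ℝ → ℝ≥0∞} (hf : Measurable f) :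
    ∫⁻ x, f x ∂expMeasure r =
      ENNReal.ofReal r * ∫⁻ x in Ioi 0, ENNReal.ofReal (Real.exp (-(r * x))) * f x := by
  have hd : expMeasure r = volume.withDensity (exponentialPDF r) := rfl
  have hm : Measurable (exponentialPDF r) := (measurable_exponentialPDFReal r).ennreal_ofReal
  rw [hd, lintegral_withDensity_eq_lintegral_mul _ hm hf, ← lintegral_const_mul _ (by fun_prop),
    setLIntegral_congr Ioi_ae_eq_Ici, ← lintegral_indicator measurableSet_Ici]
  refine lintegral_congr fun x => ?_
  simp only [Pi.mul_apply, exponentialPDF_eq, indicator_apply, mem_Ici]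
  split_ifs
  · rw [ENNReal.ofReal_mul hr.le, mul_assoc]
  · simp

theorem expMeasure_absolutelyContinuous (r : ℝ) : expMeasure r ≪ volume :=
  withDensity_absolutelyContinuous _ _

theorem ae_pos_expMeasure (r : ℝ) (hr : 0 < r) : ∀ᵐ x ∂expMeasure r, 0 < x := by
  rw [ae_iff]
  have h : {x : ℝ | ¬ 0 < x} = Iic 0 := by ext; simp
  have := isProbabilityMeasure_expMeasure hr
  rw [h, ← ofReal_cdf, cdf_expMeasure_eq hr]
  simp

theorem expMeasure_Ioi (r : ℝ) (hr : 0 < r) {x : ℝ} (hx : 0 ≤ x) :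
    expMeasure r (Ioi x) = ENNReal.ofReal (Real.exp (-(r * x))) := by
  have := isProbabilityMeasure_expMeasure hr
  rw [← compl_Iic, prob_compl_eq_one_sub measurableSet_Iic, ← ofReal_cdf, cdf_expMeasure_eq hr,
    if_pos hx, ← ENNReal.ofReal_one, ← ENNReal.ofReal_sub]
  · congr 1; ring
  · rw [sub_nonneg, Real.exp_le_one_iff]
    have := mul_nonneg hr.le hx
    linarith

theorem expMeasure_Ici (r : ℝ) (hr : 0 < r) {x : ℝ} (hx : 0 ≤ x) :
    expMeasure r (Ici x) = ENNReal.ofReal (Real.exp (-(r * x))) := by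
  rw [← expMeasure_Ioi r hr hx]
  exact measure_congr ((expMeasure_absolutelyContinuous r).ae_eq Ioi_ae_eq_Ici).symm

/-- The weight that the minimum of two independent exponential variables gives to the event that
the first one is the smaller. -/
theorem lintegral_mul_expMeasure_Ioi (ha : 0 < a) (hb : 0 < b) {f : ℝ → ℝ≥0∞}
    (hf : Measurable f) :
    ∫⁻ x, f x * expMeasure b (Ioi x) ∂expMeasure a =
      ENNReal.ofReal (a / (a + b)) * ∫⁻ x, f x ∂expMeasure (a + b) := by
  have hab : 0 < a + b := by positivity
  have h1 : ∫⁻ x, f x * expMeasure b (Ioi x) ∂expMeasure a =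
      ∫⁻ x, f x * ENNReal.ofReal (Real.exp (-(b * x))) ∂expMeasure a := by
    refine lintegral_congr_ae ?_
    filter_upwards [ae_pos_expMeasure a ha] with x hx
    rw [expMeasure_Ioi b hb hx.le]
  rw [h1, lintegral_expMeasure a ha (by fun_prop), lintegral_expMeasure (a + b) hab hf,
    ← mul_assoc, ← ENNReal.ofReal_mul (by positivity), div_mul_cancel₀ _ hab.ne']
  congr 1
  refine lintegral_congr fun x => ?_
  rw [show -((a + b) * x) = -(a * x) + -(b * x) by ring, Real.exp_add,
    ENNReal.ofReal_mul (Real.exp_pos _).le]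
  ring

theorem lintegral_expMeasure_Ioi (ha : 0 < a) (hb : 0 < b) :
    ∫⁻ x, expMeasure b (Ioi x) ∂expMeasure a = ENNReal.ofReal (a / (a + b)) := by
  have := isProbabilityMeasure_expMeasure (add_pos ha hb)
  simpa using lintegral_mul_expMeasure_Ioi ha hb (f := fun _ => 1) measurable_const

/-- Layer-cake formula: the tail of the exponential law is its density divided by `r`. -/
theorem lintegral_min_expMeasure (hr : 0 < r) {c : ℝ} (hc : 0 ≤ c) :
    ∫⁻ x, ENNReal.ofReal (min x c) ∂expMeasure r =
      ENNReal.ofReal (1 / r) * expMeasure r (Iio c) := by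
  have h1 := lintegral_eq_lintegral_meas_lt (expMeasure r) (f := fun x => min x c)
    (by filter_upwards [ae_pos_expMeasure r hr] with x hx using le_min hx.le hc) (by fun_prop)
  rw [h1, ← lintegral_indicator_one measurableSet_Iio, lintegral_expMeasure r hr
    (measurable_one.indicator measurableSet_Iio), ← mul_assoc, ← ENNReal.ofReal_mul (by positivity),
    one_div, inv_mul_cancel₀ hr.ne', ENNReal.ofReal_one, one_mul]
  refine setLIntegral_congr_fun measurableSet_Ioi fun x hx => ?_
  by_cases hxc : x < c
  · have h2 : {y : ℝ | x < min y c} = Ioi x := by ext; simp [hxc]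
    rw [h2, expMeasure_Ioi r hr (le_of_lt hx)]
    simp [hxc]
  · have h2 : {y : ℝ | x < min y c} = ∅ := by ext; simp [hxc]
    simp [hxc]

/-- One step of a renewal process stopped at `t`: the mean growth of the truncated time is the mean
gap times the probability of a further arrival before `t`. Summed over the steps, it counts
arrivals. -/
theorem lintegral_min_add_expMeasure (hr : 0 < r) {y t : ℝ} (hy : 0 ≤ y) :
    ∫⁻ x, ENNReal.ofReal (min (y + x) t) ∂expMeasure r =
      ENNReal.ofReal (min y t) + ENNReal.ofReal (1 / r) * expMeasure r {x | y + x < t} := by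
  have := isProbabilityMeasure_expMeasure hr
  have hae := ae_pos_expMeasure r hr
  rcases le_or_gt t y with h | h
  · have h1 : expMeasure r {x | y + x < t} = 0 := by
      rw [← nonpos_iff_eq_zero, ← (ae_iff.1 hae)]
      refine measure_mono fun x hx => ?_
      simp only [mem_ofPred_eq] at hx ⊢
      linarith
    rw [h1, mul_zero, add_zero, min_eq_right h]
    have : ∫⁻ x, ENNReal.ofReal (min (y + x) t) ∂expMeasure r =
        ∫⁻ x, ENNReal.ofReal t ∂expMeasure r := by
      refine lintegral_congr_ae ?_
      filter_upwards [hae] with x hx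
      rw [min_eq_right (by linarith)]
    rw [this, lintegral_const, measure_univ, mul_one]
  · have h1 : {x | y + x < t} = Iio (t - y) := by
      ext x; simp only [mem_ofPred_eq, mem_Iio]; constructor <;> intro <;> linarith
    rw [h1, min_eq_left h.le, ← lintegral_min_expMeasure hr (by linarith : 0 ≤ t - y)]
    have : ∫⁻ x, ENNReal.ofReal (min (y + x) t) ∂expMeasure r =
        ∫⁻ x, (ENNReal.ofReal y + ENNReal.ofReal (min x (t - y))) ∂expMeasure r := by
      refine lintegral_congr_ae ?_
      filter_upwards [hae] with x hx
      rw [← ENNReal.ofReal_add hy (le_min hx.le (by linarith)), ← min_add_add_left]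
      congr 2; ring
    rw [this, lintegral_add_left measurable_const]
    simp

/-- Memorylessness of the exponential distribution. -/
theorem expMeasure_Ici_add (hr : 0 < r) {x y : ℝ} (hx : 0 ≤ x) (hy : 0 ≤ y) :
    expMeasure r (Ici (x + y)) = expMeasure r (Ioi x) * expMeasure r (Ioi y) := by
  rw [expMeasure_Ici r hr (add_nonneg hx hy), expMeasure_Ioi r hr hx, expMeasure_Ioi r hr hy,
    ← ENNReal.ofReal_mul (Real.exp_pos _).le, ← Real.exp_add]
  congr 2; ring

end Exponential

namespace MatchingInstance

variable (I : MatchingInstance)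

/-! ### Arrival times -/

instance : Countable I.T := Finite.to_countable

instance : IsProbabilityMeasure I.law :=
  inferInstanceAs (IsProbabilityMeasure (Measure.infinitePi _))

/-- The arrival time of the agent of the same type who precedes `a` (or `0`). -/
def previousArrival (ω : I.Path) (a : I.Agent) : ℝ :=
  ∑ k ∈ Finset.range a.2, (ω (a.1, k)).1

/-- The next agent of the same type. -/
abbrev next {I : MatchingInstance} (a : I.Agent) : I.Agent := (a.1, a.2 + 1)

theorem arrival_eq (ω : I.Path) (a : I.Agent) :
    I.arrival ω a = I.previousArrival ω a + (ω a).1 :=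
  Finset.sum_range_succ _ _

theorem previousArrival_zero (ω : I.Path) (i : I.T) : I.previousArrival ω (i, 0) = 0 := by
  simp [previousArrival]

theorem previousArrival_next (ω : I.Path) (a : I.Agent) :
    I.previousArrival ω (next a) = I.arrival ω a := rfl

@[fun_prop]
theorem measurable_arrival {X : Type*} [MeasurableSpace X] {f : X → I.Path} (hf : Measurable f)
    (a : I.Agent) : Measurable fun x => I.arrival (f x) a := by
  unfold arrival
  fun_prop

@[fun_prop]
theorem measurable_previousArrival {X : Type*} [MeasurableSpace X] {f : X → I.Path}
    (hf : Measurable f) (a : I.Agent) : Measurable fun x => I.previousArrival (f x) a := by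
  unfold previousArrival
  fun_prop

@[fun_prop]
theorem measurable_departure {X : Type*} [MeasurableSpace X] {f : X → I.Path} (hf : Measurable f)
    (a : I.Agent) : Measurable fun x => I.departure (f x) a := by
  unfold departure
  fun_prop

/-! ### Resampling a single inter-arrival or sojourn time -/

open Classical in
/-- Replace the time between the arrival of `a` and the preceding arrival of the same type. -/
def setGap (ω : I.Path) (a : I.Agent) (g : ℝ) : I.Path := Function.update ω a (g, (ω a).2)

open Classical in
/-- Replace the maximum sojourn time of `a`. -/
def setSojourn (ω : I.Path) (a : I.Agent) (s : ℝ) : I.Path := Function.update ω a ((ω a).1, s)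

theorem setGap_fst (ω : I.Path) (a : I.Agent) (g : ℝ) : (I.setGap ω a g a).1 = g := by
  simp [setGap]

theorem setGap_snd (ω : I.Path) (a b : I.Agent) (g : ℝ) : (I.setGap ω a g b).2 = (ω b).2 := by
  by_cases h : b = a
  · subst h; simp [setGap]
  · simp [setGap, h]

theorem setGap_of_ne (ω : I.Path) {a b : I.Agent} (h : b ≠ a) (g : ℝ) :
    I.setGap ω a g b = ω b := by
  simp [setGap, h]

theorem setSojourn_snd (ω : I.Path) (a : I.Agent) (s : ℝ) : (I.setSojourn ω a s a).2 = s := by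
  simp [setSojourn]

theorem setSojourn_fst (ω : I.Path) (a b : I.Agent) (s : ℝ) :
    (I.setSojourn ω a s b).1 = (ω b).1 := by
  by_cases h : b = a
  · subst h; simp [setSojourn]
  · simp [setSojourn, h]

theorem setSojourn_of_ne (ω : I.Path) {a b : I.Agent} (h : b ≠ a) (s : ℝ) :
    I.setSojourn ω a s b = ω b := by
  simp [setSojourn, h]

theorem arrival_setSojourn (ω : I.Path) (a b : I.Agent) (s : ℝ) :
    I.arrival (I.setSojourn ω a s) b = I.arrival ω b := by
  simp [arrival, setSojourn_fst]

theorem previousArrival_setSojourn (ω : I.Path) (a b : I.Agent) (s : ℝ) :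
    I.previousArrival (I.setSojourn ω a s) b = I.previousArrival ω b := by
  simp [previousArrival, setSojourn_fst]

theorem departure_setSojourn (ω : I.Path) (a : I.Agent) (s : ℝ) :
    I.departure (I.setSojourn ω a s) a = I.arrival ω a + s := by
  rw [departure, arrival_setSojourn, setSojourn_snd]

theorem departure_setSojourn_of_ne (ω : I.Path) {a b : I.Agent} (h : b ≠ a) (s : ℝ) :
    I.departure (I.setSojourn ω a s) b = I.departure ω b := by
  rw [departure, departure, arrival_setSojourn, setSojourn_of_ne I ω h]

theorem previousArrival_setGap (ω : I.Path) {a b : I.Agent} (g : ℝ)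
    (h : b.1 = a.1 → b.2 ≤ a.2) :
    I.previousArrival (I.setGap ω a g) b = I.previousArrival ω b := by
  refine Finset.sum_congr rfl fun k hk => ?_
  rw [setGap_of_ne]
  rintro rfl
  have := h rfl
  simp only [Finset.mem_range] at hk
  omega

theorem arrival_setGap_of_lt (ω : I.Path) {a b : I.Agent} (g : ℝ) (h : b.1 = a.1 → b.2 < a.2) :
    I.arrival (I.setGap ω a g) b = I.arrival ω b :=
  previousArrival_setGap I ω (b := next b) g h

theorem arrival_setGap (ω : I.Path) (a : I.Agent) (g : ℝ) :
    I.arrival (I.setGap ω a g) a = I.previousArrival ω a + g := by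
  rw [arrival_eq, previousArrival_setGap I ω g (fun _ => le_rfl), setGap_fst]

theorem departure_setGap_of_lt (ω : I.Path) {a b : I.Agent} (g : ℝ) (h : b.1 = a.1 → b.2 < a.2) :
    I.departure (I.setGap ω a g) b = I.departure ω b := by
  rw [departure, departure, arrival_setGap_of_lt I ω g h, setGap_snd]

theorem measurable_update_prod (a : I.Agent) [DecidableEq I.Agent] :
    Measurable fun p : I.Path × (ℝ × ℝ) => Function.update p.1 a p.2 := by
  refine measurable_pi_iff.2 fun b => ?_
  by_cases h : b = a
  · subst h; simpa using measurable_snd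
  · simp only [Function.update_of_ne h]
    fun_prop

@[fun_prop]
theorem measurable_setGap {X : Type*} [MeasurableSpace X] {f : X → I.Path} {g : X → ℝ}
    (hf : Measurable f) (hg : Measurable g) (a : I.Agent) :
    Measurable fun x => I.setGap (f x) a (g x) := by
  classical
  have h : Measurable fun x => (f x, (g x, (f x a).2)) := by fun_prop
  unfold setGap
  convert! (I.measurable_update_prod a).comp h

@[fun_prop]
theorem measurable_setSojourn {X : Type*} [MeasurableSpace X] {f : X → I.Path} {g : X → ℝ}
    (hf : Measurable f) (hg : Measurable g) (a : I.Agent) :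
    Measurable fun x => I.setSojourn (f x) a (g x) := by
  classical
  have h : Measurable fun x => (f x, ((f x a).1, g x)) := by fun_prop
  unfold setSojourn
  convert! (I.measurable_update_prod a).comp h

/-- Coordinates are independent, so replacing one by an independent copy preserves the law; it
suffices to compare finite-dimensional boxes. -/
theorem map_update_law (a : I.Agent) [DecidableEq I.Agent] :
    (I.law.prod ((expMeasure (I.lam a.1)).prod (expMeasure (I.mu a.1)))).map
      (fun p => Function.update p.1 a p.2) = I.law := by
  refine Measure.eq_infinitePi _ fun s t ht => ?_
  have hms : MeasurableSet (Set.pi (s : Set I.Agent) t) :=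
    MeasurableSet.pi s.countable_toSet fun i _ => ht i
  rw [Measure.map_apply (I.measurable_update_prod a) hms]
  have hlaw : ∀ u : Finset I.Agent, I.law (Set.pi (u : Set I.Agent) t) =
      ∏ i ∈ u, ((expMeasure (I.lam i.1)).prod (expMeasure (I.mu i.1))) (t i) :=
    fun u => Measure.infinitePi_pi _ fun i _ => ht i
  by_cases ha : a ∈ s
  · have h1 : (fun p : I.Path × (ℝ × ℝ) => Function.update p.1 a p.2) ⁻¹' (Set.pi (s : Set I.Agent) t)
        = (Set.pi ((s.erase a : Finset I.Agent) : Set I.Agent) t) ×ˢ (t a) := by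
      ext p
      simp only [Set.mem_preimage, Set.mem_pi, Finset.mem_coe, Set.mem_prod, Finset.mem_erase]
      constructor
      · intro h
        refine ⟨fun i hi => ?_, ?_⟩
        · simpa [Function.update_of_ne hi.1] using h i hi.2
        · simpa using h a ha
      · intro h i hi
        by_cases hia : i = a
        · subst hia; simpa using h.2
        · simpa [Function.update_of_ne hia] using h.1 i ⟨hia, hi⟩
    rw [h1, Measure.prod_prod, hlaw, Finset.prod_erase_mul _ _ ha]
  · have h1 : (fun p : I.Path × (ℝ × ℝ) => Function.update p.1 a p.2) ⁻¹' (Set.pi (s : Set I.Agent) t)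
        = (Set.pi (s : Set I.Agent) t) ×ˢ Set.univ := by
      ext p
      simp only [Set.mem_preimage, Set.mem_pi, Finset.mem_coe, Set.mem_prod, Set.mem_univ, and_true]
      refine forall₂_congr fun i hi => ?_
      rw [Function.update_of_ne (by rintro rfl; exact ha hi)]
    rw [h1, Measure.prod_prod, hlaw, measure_univ, mul_one]

theorem lintegral_update_law (a : I.Agent) [DecidableEq I.Agent] {f : I.Path → ℝ≥0∞}
    (hf : Measurable f) :
    ∫⁻ ω, f ω ∂I.law = ∫⁻ ω, ∫⁻ g, ∫⁻ s, f (Function.update ω a (g, s))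
      ∂expMeasure (I.mu a.1) ∂expMeasure (I.lam a.1) ∂I.law := by
  have hm := I.measurable_update_prod a
  conv_lhs => rw [← I.map_update_law a]
  rw [lintegral_map hf hm, lintegral_prod (fun p : I.Path × (ℝ × ℝ) => f (Function.update p.1 a p.2))
    (hf.comp hm).aemeasurable]
  refine lintegral_congr fun ω => ?_
  rw [lintegral_prod]
  exact (hf.comp (hm.comp (by fun_prop : Measurable fun v : ℝ × ℝ => (ω, v)))).aemeasurable

/-- The whole coordinate of `a` is resampled on both sides; on the right the gap drawn this way is
overwritten and integrates out. -/
theorem lintegral_setGap (a : I.Agent) {f : I.Path → ℝ≥0∞} (hf : Measurable f) :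
    ∫⁻ ω, f ω ∂I.law = ∫⁻ ω, ∫⁻ g, f (I.setGap ω a g) ∂expMeasure (I.lam a.1) ∂I.law := by
  classical
  have hF : Measurable fun ω => ∫⁻ g, f (I.setGap ω a g) ∂expMeasure (I.lam a.1) :=
    Measurable.lintegral_prod_right' (f := fun p : I.Path × ℝ => f (I.setGap p.1 a p.2))
      (hf.comp (by fun_prop))
  have hm := I.measurable_update_prod a
  rw [I.lintegral_update_law a hF, I.lintegral_update_law a hf]
  refine lintegral_congr fun ω => ?_
  rw [lintegral_lintegral_swap (f := fun g s => f (Function.update ω a (g, s)))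
    (hf.comp (hm.comp (by fun_prop : Measurable fun v : ℝ × ℝ => (ω, v)))).aemeasurable]
  have h : ∀ g' s g, I.setGap (Function.update ω a (g', s)) a g = Function.update ω a (g, s) := by
    intro g' s g
    ext b : 1
    by_cases h : b = a
    · subst h; simp [setGap]
    · simp [setGap, h]
  simp [h]

theorem lintegral_setSojourn (a : I.Agent) {f : I.Path → ℝ≥0∞} (hf : Measurable f) :
    ∫⁻ ω, f ω ∂I.law = ∫⁻ ω, ∫⁻ s, f (I.setSojourn ω a s) ∂expMeasure (I.mu a.1) ∂I.law := by
  classical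
  have hF : Measurable fun ω => ∫⁻ s, f (I.setSojourn ω a s) ∂expMeasure (I.mu a.1) :=
    Measurable.lintegral_prod_right' (f := fun p : I.Path × ℝ => f (I.setSojourn p.1 a p.2))
      (hf.comp (by fun_prop))
  rw [I.lintegral_update_law a hF, I.lintegral_update_law a hf]
  have h : ∀ ω g s' s, I.setSojourn (Function.update ω a (g, s')) a s =
      Function.update ω a (g, s) := by
    intro ω g s' s
    ext b : 1
    by_cases h : b = a
    · subst h; simp [setSojourn]
    · simp [setSojourn, h]
  simp [h]

/-- Replace the sojourn time of `a` by `s` and the time until the next arrival of the same type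
by `g`. -/
def race (ω : I.Path) (a : I.Agent) (g s : ℝ) : I.Path :=
  I.setSojourn (I.setGap ω (next a) g) a s

@[fun_prop]
theorem measurable_race {X : Type*} [MeasurableSpace X] {f : X → I.Path} {g s : X → ℝ}
    (hf : Measurable f) (hg : Measurable g) (hs : Measurable s) (a : I.Agent) :
    Measurable fun x => I.race (f x) a (g x) (s x) := by
  unfold race
  fun_prop

theorem lintegral_race (a : I.Agent) {f : I.Path → ℝ≥0∞} (hf : Measurable f) :
    ∫⁻ ω, f ω ∂I.law = ∫⁻ ω, ∫⁻ g, ∫⁻ s, f (I.race ω a g s)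
      ∂expMeasure (I.mu a.1) ∂expMeasure (I.lam a.1) ∂I.law := by
  rw [I.lintegral_setSojourn a hf, I.lintegral_setGap (next a)]
  · rfl
  · exact Measurable.lintegral_prod_right' (f := fun p : I.Path × ℝ => f (I.setSojourn p.1 a p.2))
      (hf.comp (by fun_prop))

theorem arrival_race_of_le (ω : I.Path) {a b : I.Agent} (g s : ℝ) (h : b.1 = a.1 → b.2 ≤ a.2) :
    I.arrival (I.race ω a g s) b = I.arrival ω b := by
  rw [race, arrival_setSojourn, arrival_setGap_of_lt]
  exact fun e => Nat.lt_succ_of_le (h e)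

theorem arrival_race (ω : I.Path) (a : I.Agent) (g s : ℝ) :
    I.arrival (I.race ω a g s) a = I.arrival ω a :=
  I.arrival_race_of_le ω g s fun _ => le_rfl

theorem arrival_next_race (ω : I.Path) (a : I.Agent) (g s : ℝ) :
    I.arrival (I.race ω a g s) (next a) = I.arrival ω a + g := by
  rw [race, arrival_setSojourn, arrival_setGap, previousArrival_next]

theorem departure_race (ω : I.Path) (a : I.Agent) (g s : ℝ) :
    I.departure (I.race ω a g s) a = I.arrival ω a + s := by
  rw [race, departure_setSojourn, arrival_setGap_of_lt]
  exact fun _ => Nat.lt_succ_self _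

theorem departure_race_of_lt (ω : I.Path) {a b : I.Agent} (g s : ℝ) (h : b.1 = a.1 → b.2 < a.2) :
    I.departure (I.race ω a g s) b = I.departure ω b := by
  rw [race, departure_setSojourn_of_ne, departure_setGap_of_lt]
  · exact fun e => (h e).trans (Nat.lt_succ_self _)
  · rintro rfl
    exact lt_irrefl _ (h rfl)

/-! ### The expected number of arrivals -/

theorem ae_pos : ∀ᵐ ω ∂I.law, ∀ a, 0 < (ω a).1 ∧ 0 < (ω a).2 := by
  rw [ae_all_iff]
  intro a
  have h : ∀ᵐ v ∂(expMeasure (I.lam a.1)).prod (expMeasure (I.mu a.1)), 0 < v.1 ∧ 0 < v.2 := by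
    have h1 := Measure.quasiMeasurePreserving_fst (μ := expMeasure (I.lam a.1))
      (ν := expMeasure (I.mu a.1)) |>.ae (ae_pos_expMeasure _ (I.lam_pos a.1))
    have h2 := Measure.quasiMeasurePreserving_snd (μ := expMeasure (I.lam a.1))
      (ν := expMeasure (I.mu a.1)) |>.ae (ae_pos_expMeasure _ (I.mu_pos a.1))
    filter_upwards [h1, h2] with v h1 h2 using ⟨h1, h2⟩
  exact (measurePreserving_eval_infinitePi (fun a : I.Agent =>
    (expMeasure (I.lam a.1)).prod (expMeasure (I.mu a.1))) a).quasiMeasurePreserving.ae h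

theorem previousArrival_nonneg {ω : I.Path} (h : ∀ a, 0 < (ω a).1 ∧ 0 < (ω a).2) (a : I.Agent) :
    0 ≤ I.previousArrival ω a :=
  Finset.sum_nonneg fun _ _ => (h _).1.le

theorem lintegral_min_arrival (a : I.Agent) (t : ℝ) :
    ∫⁻ ω, ENNReal.ofReal (min (I.arrival ω a) t) ∂I.law =
      ∫⁻ ω, ENNReal.ofReal (min (I.previousArrival ω a) t) ∂I.law +
        ENNReal.ofReal (1 / I.lam a.1) * I.law {ω | I.arrival ω a < t} := by
  have hms : MeasurableSet {ω | I.arrival ω a < t} :=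
    measurableSet_lt (by fun_prop) measurable_const
  have h1 : I.law {ω | I.arrival ω a < t} =
      ∫⁻ ω, expMeasure (I.lam a.1) {g | I.previousArrival ω a + g < t} ∂I.law := by
    rw [← lintegral_indicator_one hms, I.lintegral_setGap a (measurable_one.indicator hms)]
    refine lintegral_congr fun ω => ?_
    rw [← lintegral_indicator_one (measurableSet_lt (by fun_prop) measurable_const)]
    refine lintegral_congr fun g => ?_
    simp [Set.indicator_apply, arrival_setGap]
  rw [h1, ← lintegral_const_mul' _ _ ENNReal.ofReal_ne_top,
    ← lintegral_add_left (by fun_prop), I.lintegral_setGap a (by fun_prop)]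
  refine lintegral_congr_ae ?_
  filter_upwards [I.ae_pos] with ω hω
  simp only [arrival_setGap]
  exact lintegral_min_add_expMeasure (I.lam_pos a.1) (I.previousArrival_nonneg hω a)

theorem sum_law_arrival_lt (i : I.T) {t : ℝ} (ht : 0 ≤ t) (n : ℕ) :
    ENNReal.ofReal (1 / I.lam i) * ∑ k ∈ Finset.range n, I.law {ω | I.arrival ω (i, k) < t} =
      ∫⁻ ω, ENNReal.ofReal (min (I.previousArrival ω (i, n)) t) ∂I.law := by
  induction n with
  | zero => simp [previousArrival_zero, ht]
  | succ n ih =>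
    rw [Finset.sum_range_succ, mul_add, ih]
    exact (I.lintegral_min_arrival (i, n) t).symm

/-- Only an upper bound at this point: equality needs arrival times to tend to infinity, and that
(`ae_regular`) is deduced from this bound by Borel–Cantelli. -/
theorem tsum_law_arrival_lt_le (i : I.T) {t : ℝ} (ht : 0 ≤ t) :
    ENNReal.ofReal (1 / I.lam i) * ∑' k, I.law {ω | I.arrival ω (i, k) < t} ≤
      ENNReal.ofReal t := by
  rw [ENNReal.tsum_eq_iSup_nat, ENNReal.mul_iSup]
  refine iSup_le fun n => ?_
  rw [I.sum_law_arrival_lt i ht n]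
  refine (lintegral_mono fun ω => ENNReal.ofReal_le_ofReal (min_le_right _ t)).trans ?_
  simp

theorem tsum_law_arrival_lt_ne_top (i : I.T) {t : ℝ} (ht : 0 ≤ t) :
    ∑' k, I.law {ω | I.arrival ω (i, k) < t} ≠ ∞ := by
  intro h
  have h1 := I.tsum_law_arrival_lt_le i ht
  rw [h, ENNReal.mul_top] at h1
  · exact ENNReal.ofReal_ne_top (top_le_iff.1 h1)
  · simpa using I.lam_pos i

theorem ae_regular : ∀ᵐ ω ∂I.law, I.Regular ω := by
  have h1 : ∀ᵐ ω ∂I.law, ∀ i : I.T, ∀ m : ℕ, ∀ᶠ k in atTop, ¬ I.arrival ω (i, k) < m := by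
    rw [ae_all_iff]
    intro i
    rw [ae_all_iff]
    intro m
    exact ae_eventually_notMem (I.tsum_law_arrival_lt_ne_top i (Nat.cast_nonneg m))
  filter_upwards [I.ae_pos, h1] with ω hω h2
  refine ⟨hω, fun i => tendsto_atTop.2 fun b => ?_⟩
  obtain ⟨m, hm⟩ := exists_nat_ge b
  filter_upwards [h2 i m] with k hk
  exact hm.trans (not_lt.1 hk)

variable {I} in
theorem Regular.arrival_mono {ω : I.Path} (hω : I.Regular ω) (i : I.T) :
    StrictMono fun k => I.arrival ω (i, k) :=
  strictMono_nat_of_lt_succ fun k => by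
    rw [I.arrival_eq ω (i, k + 1), show (i, k + 1) = next (i, k) from rfl, previousArrival_next]
    linarith [(hω.1 (next (i, k))).1]

variable {I} in
theorem Regular.arrival_pos {ω : I.Path} (hω : I.Regular ω) (a : I.Agent) :
    0 < I.arrival ω a := by
  rw [arrival_eq]
  linarith [I.previousArrival_nonneg hω.1 a, (hω.1 a).1]

variable {I} in
theorem Regular.arrival_lt_departure {ω : I.Path} (hω : I.Regular ω) (a : I.Agent) :
    I.arrival ω a < I.departure ω a := by
  unfold departure
  linarith [(hω.1 a).2]

/-- The expected number of arrivals of type `i` before `t` is `lam i * t`. -/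
theorem tsum_law_arrival_lt (i : I.T) {t : ℝ} (ht : 0 ≤ t) :
    ∑' k, I.law {ω | I.arrival ω (i, k) < t} = ENNReal.ofReal (I.lam i * t) := by
  have hl := I.lam_pos i
  have h1 : Tendsto (fun n => ∫⁻ ω, ENNReal.ofReal (min (I.previousArrival ω (i, n)) t) ∂I.law)
      atTop (nhds (∫⁻ _, ENNReal.ofReal t ∂I.law)) := by
    refine lintegral_tendsto_of_tendsto_of_monotone (fun n => by fun_prop) ?_ ?_
    · filter_upwards [I.ae_pos] with ω hω
      refine monotone_nat_of_le_succ fun n => ENNReal.ofReal_le_ofReal (min_le_min_right _ ?_)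
      rw [show (i, n + 1) = next (i, n) from rfl, previousArrival_next, arrival_eq]
      linarith [(hω (i, n)).1]
    · filter_upwards [I.ae_regular] with ω hω
      refine tendsto_const_nhds.congr' ?_
      have h2 : Tendsto (fun k => I.previousArrival ω (i, k)) atTop atTop :=
        (tendsto_add_atTop_iff_nat 1).1 (hω.2 i)
      filter_upwards [h2.eventually_ge_atTop t] with n hn
      rw [min_eq_right hn]
  have h2 : Tendsto (fun n => ENNReal.ofReal (1 / I.lam i) *
      ∑ k ∈ Finset.range n, I.law {ω | I.arrival ω (i, k) < t}) atTop
      (nhds (ENNReal.ofReal (1 / I.lam i) * ∑' k, I.law {ω | I.arrival ω (i, k) < t})) :=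
    ENNReal.Tendsto.const_mul (ENNReal.tendsto_nat_tsum _) (Or.inr ENNReal.ofReal_ne_top)
  simp only [I.sum_law_arrival_lt i ht] at h2
  have h3 := tendsto_nhds_unique h2 h1
  rw [lintegral_const, measure_univ, mul_one] at h3
  rw [ENNReal.ofReal_mul hl.le, ← h3, ← mul_assoc, ← ENNReal.ofReal_mul hl.le,
    mul_one_div_cancel hl.ne', ENNReal.ofReal_one, one_mul]

/-- At most one agent is the last of its type before `t`. This bounds the boundary effects at the
horizon, which vanish after division by `t`. -/
theorem tsum_law_arrival_lt_le_one (i : I.T) (t : ℝ) :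
    ∑' k, I.law {ω | I.arrival ω (i, k) < t ∧ t ≤ I.arrival ω (next (i, k))} ≤ 1 := by
  rw [← measure_iUnion₀]
  · exact prob_le_one
  · intro k l hkl
    refine measure_mono_null ?_ (ae_iff.1 I.ae_regular)
    rintro ω ⟨⟨h1, h2⟩, h3, h4⟩ hω
    have hm := (hω.arrival_mono i).monotone
    rcases lt_or_gt_of_ne hkl with h | h
    · exact absurd (hm (Nat.succ_le_of_lt h)) (not_le.2 (h3.trans_le h2))
    · exact absurd (hm (Nat.succ_le_of_lt h)) (not_le.2 (h1.trans_le h4))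
  · exact fun k => (measurableSet_setOfPred.2 (by fun_prop)).nullMeasurableSet

end MatchingInstance

/-- Integrability need not be known: otherwise the integral is `0` by convention, and `0 ≤ c`. -/
theorem integral_le_of_lintegral_ofReal_le {X : Type*} [MeasurableSpace X] {μ : Measure X}
    {f : X → ℝ} (hf : ∀ x, 0 ≤ f x) {c : ℝ} (hc : 0 ≤ c)
    (h : ∫⁻ x, ENNReal.ofReal (f x) ∂μ ≤ ENNReal.ofReal c) : ∫ x, f x ∂μ ≤ c := by
  by_cases hi : Integrable f μ
  · rw [integral_eq_lintegral_of_nonneg_ae (.of_forall hf) hi.1]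
    exact ENNReal.toReal_le_of_le_ofReal hc h
  · rwa [integral_undef hi]

namespace MatchingInstance

variable {I : MatchingInstance}

/-! ### Upper bound on the value of online policies -/

theorem arrival_setGap_of_le (ω : I.Path) {a : I.Agent} (g : ℝ) {n : ℕ} (h : a.2 ≤ n) :
    I.arrival (I.setGap ω a g) (a.1, n) = I.arrival ω (a.1, n) + (g - (ω a).1) := by
  induction n, h using Nat.le_induction with
  | base => rw [arrival_setGap, arrival_eq]; ring
  | succ n hn ih =>
    rw [arrival_eq, arrival_eq, show (a.1, n + 1) = next (a.1, n) from rfl, previousArrival_next,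
      previousArrival_next, ih, setGap_of_ne]
    · ring
    · intro h
      have := congrArg Prod.snd h
      simp only at this
      omega

theorem Regular.setGap {ω : I.Path} (hω : I.Regular ω) (a : I.Agent) {g : ℝ} (hg : 0 < g) :
    I.Regular (I.setGap ω a g) := by
  refine ⟨fun b => ⟨?_, ?_⟩, fun i => ?_⟩
  · by_cases h : b = a
    · subst h; rwa [setGap_fst]
    · rw [setGap_of_ne I ω h]; exact (hω.1 b).1
  · rw [setGap_snd]; exact (hω.1 b).2
  · by_cases h : i = a.1
    · subst h
      refine (tendsto_atTop_add_const_right _ (g - (ω a).1) (hω.2 a.1)).congr' ?_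
      filter_upwards [eventually_ge_atTop a.2] with n hn
      rw [arrival_setGap_of_le ω g hn]
    · refine (hω.2 i).congr fun n => ?_
      rw [arrival_setGap_of_lt]
      exact fun e => absurd e h

theorem Regular.setSojourn {ω : I.Path} (hω : I.Regular ω) (a : I.Agent) {s : ℝ} (hs : 0 < s) :
    I.Regular (I.setSojourn ω a s) := by
  refine ⟨fun b => ⟨?_, ?_⟩, fun i => ?_⟩
  · rw [setSojourn_fst]; exact (hω.1 b).1
  · by_cases h : b = a
    · subst h; rwa [setSojourn_snd]
    · rw [setSojourn_of_ne I ω h]; exact (hω.1 b).2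
  · simpa only [arrival_setSojourn] using hω.2 i

theorem Regular.race {ω : I.Path} (hω : I.Regular ω) (a : I.Agent) {g s : ℝ} (hg : 0 < g)
    (hs : 0 < s) : I.Regular (I.race ω a g s) :=
  (hω.setGap (next a) hg).setSojourn a hs

/-- Before the earlier of the departure of `a` and the next arrival of its type, these two times
are not observable. -/
theorem sameObservation_race {ω : I.Path} (hω : I.Regular ω) (a : I.Agent) {g s g' s' t : ℝ}
    (hg : 0 < g) (hs : 0 < s) (hg' : 0 < g') (hs' : 0 < s')
    (h : t < I.arrival ω a + min g s) (h' : t < I.arrival ω a + min g' s') :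
    I.SameObservation t (I.race ω a g s) (I.race ω a g' s') := by
  -- Changing `g` and `s` affects only later arrivals of the type of `a`, their departures, and the
  -- departure of `a`; all of these lie beyond `t`.
  have key : ∀ g s, 0 < g → 0 < s → t < I.arrival ω a + min g s → ∀ n, a.2 < n →
      t < I.arrival (I.race ω a g s) (a.1, n) := by
    intro g s hg hs h n hn
    have h1 := ((hω.race a hg hs).arrival_mono a.1).monotone (Nat.succ_le_of_lt hn)
    have h2 := I.arrival_next_race ω a g s
    have h3 := min_le_left g s
    simp only [next, Nat.succ_eq_add_one] at h1 h2
    linarith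
  have key' : ∀ g s, 0 < g → 0 < s → t < I.arrival ω a + min g s → ∀ n, a.2 ≤ n →
      t < I.departure (I.race ω a g s) (a.1, n) := by
    intro g s hg hs h n hn
    rcases hn.eq_or_lt with e | hlt
    · subst e
      rw [Prod.mk.eta, departure_race]
      linarith [min_le_right g s]
    · exact (key g s hg hs h n hlt).trans ((hω.race a hg hs).arrival_lt_departure _)
  constructor
  · rintro ⟨j, n⟩ hb
    by_cases hc : j = a.1 → n ≤ a.2
    · rw [arrival_race_of_le I ω g s hc, arrival_race_of_le I ω g' s' hc]
    · push Not at hc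
      obtain ⟨rfl, hc⟩ := hc
      rcases hb with hb | hb
      · exact absurd hb (not_le.2 (key g s hg hs h n hc))
      · exact absurd hb (not_le.2 (key g' s' hg' hs' h' n hc))
  · rintro ⟨j, n⟩ hb
    by_cases hc : j = a.1 → n < a.2
    · rw [departure_race_of_lt I ω g s hc, departure_race_of_lt I ω g' s' hc]
    · push Not at hc
      obtain ⟨rfl, hc⟩ := hc
      rcases hb with hb | hb
      · exact absurd hb (not_le.2 (key' g s hg hs h n hc))
      · exact absurd hb (not_le.2 (key' g' s' hg' hs' h' n hc))

/-- A property of realizations depends on the departure of `a` and on the next arrival of its type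
only through the earlier of the two. -/
def DependsOnMin (a : I.Agent) (H : I.Path → Prop) : Prop :=
  ∀ ω, I.Regular ω → ∀ g s g' s' : ℝ, 0 < g → 0 < s → 0 < g' → 0 < s' → min g s = min g' s' →
    H (I.race ω a g s) → H (I.race ω a g' s')

theorem DependsOnMin.iff {a : I.Agent} {H : I.Path → Prop} (hH : DependsOnMin a H) {ω : I.Path}
    (hω : I.Regular ω) {g s g' s' : ℝ} (hg : 0 < g) (hs : 0 < s) (hg' : 0 < g') (hs' : 0 < s')
    (h : min g s = min g' s') : H (I.race ω a g s) ↔ H (I.race ω a g' s') :=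
  ⟨hH ω hω g s g' s' hg hs hg' hs' h, hH ω hω g' s' g s hg' hs' hg hs h.symm⟩

theorem measurableSet_race_diag {a : I.Agent} {H : I.Path → Prop} (hm : Measurable H) (ω : I.Path) :
    MeasurableSet {x : ℝ | H (I.race ω a x x)} :=
  measurableSet_setOfPred.2 (hm.comp (by fun_prop : Measurable fun x : ℝ => I.race ω a x x))

/-- The next arrival of its type and the departure of `a` compete at constant rates. -/
theorem DependsOnMin.law_arrival_lt_departure {a : I.Agent} {H : I.Path → Prop}
    (hH : DependsOnMin a H) (hm : Measurable H) :
    I.law {ω | H ω ∧ I.arrival ω (next a) < I.departure ω a} =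
      ENNReal.ofReal (I.lam a.1 / (I.lam a.1 + I.mu a.1)) *
        ∫⁻ ω, expMeasure (I.lam a.1 + I.mu a.1) {x | H (I.race ω a x x)} ∂I.law := by
  classical
  have hlam := I.lam_pos a.1
  have hmu := I.mu_pos a.1
  have hms : MeasurableSet {ω | H ω ∧ I.arrival ω (next a) < I.departure ω a} :=
    measurableSet_setOfPred.2 (by fun_prop)
  rw [← lintegral_indicator_one hms, I.lintegral_race a (measurable_one.indicator hms),
    ← lintegral_const_mul' _ _ ENNReal.ofReal_ne_top]
  refine lintegral_congr_ae ?_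
  filter_upwards [I.ae_regular] with ω hω
  have hd := measurableSet_race_diag (a := a) hm ω
  rw [← lintegral_indicator_one hd,
    ← lintegral_mul_expMeasure_Ioi hlam hmu (measurable_one.indicator hd)]
  refine lintegral_congr_ae ?_
  filter_upwards [ae_pos_expMeasure _ hlam] with g hg
  rw [← lintegral_indicator_one measurableSet_Ioi,
    ← lintegral_const_mul _ (measurable_one.indicator measurableSet_Ioi)]
  refine lintegral_congr_ae ?_
  filter_upwards [ae_pos_expMeasure _ hmu] with s hs
  simp only [Set.indicator_apply, Set.mem_ofPred_eq, arrival_next_race, departure_race,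
    add_lt_add_iff_left, Set.mem_Ioi]
  by_cases hgs : g < s
  -- Here `min g s = g = min g g`, so `(g, s)` can be moved to the diagonal.
  · simp [hgs, hH.iff hω hg hs hg hg (by simp [hgs.le])]
  · simp [hgs]

/-- The next arrival of its type and the departure of `a` compete at constant rates. -/
theorem DependsOnMin.law_departure_lt_arrival {a : I.Agent} {H : I.Path → Prop}
    (hH : DependsOnMin a H) (hm : Measurable H) :
    I.law {ω | H ω ∧ I.departure ω a < I.arrival ω (next a)} =
      ENNReal.ofReal (I.mu a.1 / (I.lam a.1 + I.mu a.1)) *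
        ∫⁻ ω, expMeasure (I.lam a.1 + I.mu a.1) {x | H (I.race ω a x x)} ∂I.law := by
  classical
  have hlam := I.lam_pos a.1
  have hmu := I.mu_pos a.1
  have hms : MeasurableSet {ω | H ω ∧ I.departure ω a < I.arrival ω (next a)} :=
    measurableSet_setOfPred.2 (by fun_prop)
  rw [← lintegral_indicator_one hms, I.lintegral_race a (measurable_one.indicator hms),
    ← lintegral_const_mul' _ _ ENNReal.ofReal_ne_top]
  refine lintegral_congr_ae ?_
  filter_upwards [I.ae_regular] with ω hω
  have hd := measurableSet_race_diag (a := a) hm ω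
  have hr : Measurable fun p : ℝ × ℝ => I.race ω a p.1 p.2 := by fun_prop
  rw [lintegral_lintegral_swap (f := fun g s => Set.indicator {ω | H ω ∧
    I.departure ω a < I.arrival ω (next a)} 1 (I.race ω a g s)) ((measurable_one.indicator hms).comp hr).aemeasurable,
    ← lintegral_indicator_one hd, add_comm,
    ← lintegral_mul_expMeasure_Ioi hmu hlam (measurable_one.indicator hd)]
  refine lintegral_congr_ae ?_
  filter_upwards [ae_pos_expMeasure _ hmu] with s hs
  rw [← lintegral_indicator_one measurableSet_Ioi,
    ← lintegral_const_mul _ (measurable_one.indicator measurableSet_Ioi)]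
  refine lintegral_congr_ae ?_
  filter_upwards [ae_pos_expMeasure _ hlam] with g hg
  simp only [Set.indicator_apply, Set.mem_ofPred_eq, arrival_next_race, departure_race,
    add_lt_add_iff_left, Set.mem_Ioi]
  by_cases hgs : s < g
  · simp [hgs, hH.iff hω hg hs hs hs (by simp [hgs.le])]
  · simp [hgs]

namespace OnlinePolicy

variable (π : I.OnlinePolicy)

/-- The agent `a` is not matched with a later agent before it departs or the next agent of its type
arrives. -/
def Unmatched (u : π.Seed) (ω : I.Path) (a : I.Agent) : Prop :=
  ∀ b, ((min (I.arrival ω (next a)) (I.departure ω a) : ℝ) : EReal) ≤ π.matchTime u ω a b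

theorem measurable_matchTime_right (u : π.Seed) (a b : I.Agent) :
    Measurable fun ω => π.matchTime u ω a b :=
  (π.measurable a b).comp (by fun_prop : Measurable fun ω : I.Path => (u, ω))

@[fun_prop]
theorem measurable_unmatched (u : π.Seed) (a : I.Agent) :
    Measurable fun ω => π.Unmatched u ω a := by
  have := π.measurable_matchTime_right u a
  unfold Unmatched
  fun_prop

/-- Both realizations look the same until the common minimum, so by non-anticipation a match of `a`
made before it in one is made in the other as well. -/
theorem unmatched_race (u : π.Seed) {ω : I.Path} (hω : I.Regular ω) (a : I.Agent)
    {g s g' s' : ℝ} (hg : 0 < g) (hs : 0 < s) (hg' : 0 < g') (hs' : 0 < s')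
    (h : min g s = min g' s') (hU : π.Unmatched u (I.race ω a g s) a) :
    π.Unmatched u (I.race ω a g' s') a := by
  intro b
  by_contra hlt
  -- The observation time `t` must be real and strictly before the minimum, hence the interpolation.
  rw [not_le, EReal.lt_iff_exists_real_btwn] at hlt
  obtain ⟨t, ht1, ht2⟩ := hlt
  rw [arrival_next_race, departure_race, min_add_add_left, EReal.coe_lt_coe_iff] at ht2
  have h1 := π.nonanticipating u t _ _ (hω.race a hg' hs') (hω.race a hg hs)
    (sameObservation_race hω a hg' hs' hg hs ht2 (by rwa [h])) a b ht1.le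
  have h2 := hU b
  rw [h1, arrival_next_race, departure_race, min_add_add_left, h] at h2
  exact absurd (h2.trans ht1.le) (not_le.2 (EReal.coe_lt_coe_iff.2 ht2))

/-- As long as `a` stays unmatched, the next arrival of its type and its departure compete at
constant rates. -/
theorem law_unmatched (u : π.Seed) (a : I.Agent) (t : ℝ) :
    ENNReal.ofReal (I.mu a.1) * I.law {ω | (I.arrival ω a < t ∧ π.Unmatched u ω a) ∧
        I.arrival ω (next a) < I.departure ω a} =
      ENNReal.ofReal (I.lam a.1) * I.law {ω | (I.arrival ω a < t ∧ π.Unmatched u ω a) ∧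
        I.departure ω a < I.arrival ω (next a)} := by
  have hH : DependsOnMin a fun ω => I.arrival ω a < t ∧ π.Unmatched u ω a := by
    intro ω hω g s g' s' hg hs hg' hs' h hU
    refine ⟨?_, π.unmatched_race u hω a hg hs hg' hs' h hU.2⟩
    rw [arrival_race]
    simpa only [arrival_race] using hU.1
  rw [hH.law_arrival_lt_departure (by fun_prop), hH.law_departure_lt_arrival (by fun_prop),
    ← mul_assoc, ← mul_assoc, ← ENNReal.ofReal_mul (I.mu_pos a.1).le,
    ← ENNReal.ofReal_mul (I.lam_pos a.1).le]
  congr 2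
  ring

/-- The reward of the matches made before `t` between `a` and later agents, pathwise. -/
theorem tsum_reward_le {i : I.T} {c : ℝ} (hr : ∀ j, j ≠ i → I.r i j ≤ c)
    (u : π.Seed) {ω : I.Path} (hω : I.Regular ω) (t : ℝ) (k : ℕ) :
    (∑' b, ENNReal.ofReal (open Classical in
        if π.matchTime u ω (i, k) b < (t : EReal) then I.r i b.1 else 0)) +
      ENNReal.ofReal c * Set.indicator {ω | (I.arrival ω (i, k) < t ∧ π.Unmatched u ω (i, k)) ∧
        I.departure ω (i, k) < I.arrival ω (next (i, k))} 1 ω ≤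
    ENNReal.ofReal c * Set.indicator {ω | I.arrival ω (i, k) < t} 1 ω +
      ENNReal.ofReal (I.r i i) * Set.indicator {ω | (I.arrival ω (i, k) < t ∧
        π.Unmatched u ω (i, k)) ∧ I.arrival ω (next (i, k)) < I.departure ω (i, k)} 1 ω := by
  classical
  by_cases hex : ∃ b, π.matchTime u ω (i, k) b < (t : EReal)
  · obtain ⟨⟨j, l⟩, hb⟩ := hex
    obtain ⟨h1, h2, h3, h4⟩ := π.feasible u ω hω (i, k) (j, l) (hb.trans_le le_top).ne
    have hat : I.arrival ω (i, k) < t :=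
      h1.trans (EReal.coe_lt_coe_iff.1 (h2.trans_lt hb))
    have huniq : ∀ b, b ≠ (j, l) → π.matchTime u ω (i, k) b = ⊤ := by
      intro b hne
      by_contra hb'
      exact (π.matching u ω hω (i, k) (j, l) (i, k) b (hb.trans_le le_top).ne hb'
        (fun e => hne (congrArg Prod.snd e).symm)).1 rfl
    have hnot : ¬ ((I.arrival ω (i, k) < t ∧ π.Unmatched u ω (i, k)) ∧
        I.departure ω (i, k) < I.arrival ω (next (i, k))) := by
      rintro ⟨⟨-, hU⟩, hlt⟩
      have := hU (j, l)
      rw [min_eq_right hlt.le] at this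
      exact absurd this (not_le.2 h3)
    rw [tsum_eq_single (j, l) (fun b hne => by simp [huniq b hne]), if_pos hb]
    simp only [Set.indicator_apply, Set.mem_ofPred_eq, hat, true_and, Pi.one_apply]
    rw [if_neg (by simpa only [hat, true_and] using hnot), mul_zero, add_zero, if_pos trivial,
      mul_one]
    -- A partner of type `i` is no earlier than `next (i, k)`, so `(i, k)` is still unmatched and
    -- present when that agent arrives; the last term on the right pays for the match.
    by_cases hji : j = i
    · subst hji
      have hkl : k < l := (hω.arrival_mono j).lt_iff_lt.1 h1
      have hle : I.arrival ω (next (j, k)) ≤ I.arrival ω (j, l) :=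
        (hω.arrival_mono j).monotone (Nat.succ_le_of_lt hkl)
      have hle' : (I.arrival ω (next (j, k)) : EReal) ≤ π.matchTime u ω (j, k) (j, l) :=
        (EReal.coe_le_coe_iff.2 hle).trans h2
      have hU : π.Unmatched u ω (j, k) := by
        intro b
        by_cases hbe : b = (j, l)
        · subst hbe
          exact (EReal.coe_le_coe_iff.2 (min_le_left _ _)).trans hle'
        · rw [huniq b hbe]; exact le_top
      rw [if_pos ⟨hU, EReal.coe_lt_coe_iff.1 (hle'.trans_lt h3)⟩, mul_one]
      exact le_add_self
    · exact (ENNReal.ofReal_le_ofReal (hr j hji)).trans le_self_add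
  · push Not at hex
    have h0 : ∀ b, ¬ π.matchTime u ω (i, k) b < (t : EReal) := fun b => not_lt.2 (hex b)
    simp only [h0, if_false, ENNReal.ofReal_zero, tsum_zero, zero_add]
    refine le_trans ?_ le_self_add
    gcongr
    intro h
    exact h.1.1

theorem measurable_reward (i : I.T) (k : ℕ) (t : ℝ) :
    Measurable fun x : π.Seed × I.Path => ∑' b, ENNReal.ofReal (open Classical in
      if π.matchTime x.1 x.2 (i, k) b < (t : EReal) then I.r i b.1 else 0) := by
  refine Measurable.tsum fun b => (Measurable.ite ?_ ?_ ?_).ennreal_ofReal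
  · exact measurableSet_lt (π.measurable (i, k) b) measurable_const
  · exact measurable_const
  · exact measurable_const

/-- On average the two race terms of `tsum_reward_le` compensate: by `law_unmatched`, winning the
race is `lam i / mu i` times as likely as losing it, and `hri` makes the gain of `r i i` at most the
loss of `c`. -/
theorem lintegral_reward_le {i : I.T} {c : ℝ} (hr : ∀ j, j ≠ i → I.r i j ≤ c)
    (hri : I.r i i * I.lam i ≤ c * I.mu i) (u : π.Seed) (t : ℝ) (k : ℕ) :
    ∫⁻ ω, ∑' b, ENNReal.ofReal (open Classical in
        if π.matchTime u ω (i, k) b < (t : EReal) then I.r i b.1 else 0) ∂I.law ≤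
      ENNReal.ofReal c * I.law {ω | I.arrival ω (i, k) < t} := by
  have hU : Measurable fun ω => π.Unmatched u ω (i, k) := π.measurable_unmatched u (i, k)
  have hs1 : MeasurableSet {ω | I.arrival ω (i, k) < t} := measurableSet_setOfPred.2 (by fun_prop)
  have hs2 : MeasurableSet {ω | (I.arrival ω (i, k) < t ∧ π.Unmatched u ω (i, k)) ∧
      I.departure ω (i, k) < I.arrival ω (next (i, k))} := measurableSet_setOfPred.2 (by fun_prop)
  have hs3 : MeasurableSet {ω | (I.arrival ω (i, k) < t ∧ π.Unmatched u ω (i, k)) ∧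
      I.arrival ω (next (i, k)) < I.departure ω (i, k)} := measurableSet_setOfPred.2 (by fun_prop)
  have h1 := lintegral_mono_ae (μ := I.law) (I.ae_regular.mono fun ω hω =>
    π.tsum_reward_le hr u hω t k)
  rw [lintegral_add_right _ ((measurable_one.indicator hs2).const_mul _),
    lintegral_add_right _ ((measurable_one.indicator hs3).const_mul _),
    lintegral_const_mul _ (measurable_one.indicator hs1),
    lintegral_const_mul _ (measurable_one.indicator hs2),
    lintegral_const_mul _ (measurable_one.indicator hs3), lintegral_indicator_one hs1,
    lintegral_indicator_one hs2, lintegral_indicator_one hs3] at h1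
  have hmu := I.mu_pos i
  have h2 := π.law_unmatched u (i, k) t
  have h3 : ∀ p q : ℝ≥0∞, ENNReal.ofReal (I.mu i) * p = ENNReal.ofReal (I.lam i) * q →
      ENNReal.ofReal (I.r i i) * p ≤ ENNReal.ofReal c * q := by
    intro p q hpq
    have hp : p = ENNReal.ofReal (I.lam i / I.mu i) * q := by
      rw [div_eq_inv_mul, ENNReal.ofReal_mul (inv_nonneg.2 hmu.le), mul_assoc, ← hpq, ← mul_assoc,
        ← ENNReal.ofReal_mul (inv_nonneg.2 hmu.le), inv_mul_cancel₀ hmu.ne', ENNReal.ofReal_one,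
        one_mul]
    rw [hp, ← mul_assoc, ← ENNReal.ofReal_mul' (div_nonneg (I.lam_pos i).le hmu.le)]
    gcongr
    rwa [← mul_div_assoc, div_le_iff₀ hmu]
  have h4 := h1.trans (add_le_add_right (h3 _ _ h2) _)
  exact (ENNReal.add_le_add_iff_right
    (ENNReal.mul_ne_top ENNReal.ofReal_ne_top (measure_ne_top _ _))).1 h4

/-- An inequality suffices and avoids a summability proof: a divergent real `tsum` is `0`. -/
theorem ofReal_totalReward_le (hr : ∀ i j, 0 ≤ I.r i j) (t : ℝ) (u : π.Seed) (ω : I.Path) :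
    ENNReal.ofReal (π.totalReward t u ω) ≤ ∑' a : I.Agent, ∑' b, ENNReal.ofReal (open Classical in
        if π.matchTime u ω a b < (t : EReal) then I.r a.1 b.1 else 0) := by
  classical
  rw [totalReward, ← ENNReal.tsum_prod (f := fun a b => ENNReal.ofReal (
        if π.matchTime u ω a b < (t : EReal) then I.r a.1 b.1 else 0))]
  by_cases hs : Summable fun p : I.Agent × I.Agent =>
      if π.matchTime u ω p.1 p.2 < (t : EReal) then I.r p.1.1 p.2.1 else 0
  · rw [ENNReal.ofReal_tsum_of_nonneg _ hs]
    intro p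
    split_ifs
    · exact hr _ _
    · exact le_rfl
  · rw [tsum_eq_zero_of_not_summable hs, ENNReal.ofReal_zero]
    exact zero_le

theorem totalReward_nonneg (hr : ∀ i j, 0 ≤ I.r i j) (t : ℝ) (u : π.Seed) (ω : I.Path) :
    0 ≤ π.totalReward t u ω := by
  refine tsum_nonneg fun p => ?_
  split_ifs
  · exact hr _ _
  · exact le_rfl

theorem value_nonneg (hr : ∀ i j, 0 ≤ I.r i j) {t : ℝ} (ht : 0 < t) : 0 ≤ π.value t :=
  mul_nonneg (by positivity) (integral_nonneg fun _ => π.totalReward_nonneg hr t _ _)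

/-- If the earlier agent of every profitable pair has type `i`, and waiting for a second agent of
type `i` is at most as profitable as an immediate reward `c`, then no online policy earns more than
`c` per arrival of type `i`. -/
theorem value_le {i : I.T} {c : ℝ} (hc : 0 ≤ c) (hr0 : ∀ j l, 0 ≤ I.r j l)
    (hr1 : ∀ j l, j ≠ i → I.r j l = 0) (hr : ∀ j, j ≠ i → I.r i j ≤ c)
    (hri : I.r i i * I.lam i ≤ c * I.mu i) {t : ℝ} (ht : 0 < t) :
    π.value t ≤ c * I.lam i := by
  classical
  have hl := I.lam_pos i
  have hmain : ∫ x, π.totalReward t x.1 x.2 ∂π.jointLaw ≤ c * (I.lam i * t) := by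
    refine integral_le_of_lintegral_ofReal_le (fun x => π.totalReward_nonneg hr0 t _ _)
      (by positivity) ?_
    calc ∫⁻ x, ENNReal.ofReal (π.totalReward t x.1 x.2) ∂π.jointLaw
        ≤ ∫⁻ x, ∑' k, ∑' b, ENNReal.ofReal (if π.matchTime x.1 x.2 (i, k) b < (t : EReal)
            then I.r i b.1 else 0) ∂π.jointLaw := by
          refine lintegral_mono fun x => (π.ofReal_totalReward_le hr0 t x.1 x.2).trans ?_
          rw [ENNReal.tsum_prod', tsum_eq_single i]
          intro j hj
          simp [hr1 j _ hj]
      _ = ∑' k, ∫⁻ x, ∑' b, ENNReal.ofReal (if π.matchTime x.1 x.2 (i, k) b < (t : EReal)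
            then I.r i b.1 else 0) ∂π.jointLaw :=
          lintegral_tsum fun k => (π.measurable_reward i k t).aemeasurable
      _ ≤ ∑' k, ENNReal.ofReal c * I.law {ω | I.arrival ω (i, k) < t} := by
          refine ENNReal.tsum_le_tsum fun k => ?_
          -- By independence the seed can be fixed: the bound holds for each deterministic policy of
          -- the mixture.
          rw [jointLaw, lintegral_prod _ (π.measurable_reward i k t).aemeasurable]
          refine (lintegral_mono fun u => π.lintegral_reward_le hr hri u t k).trans ?_
          simp
      _ = ENNReal.ofReal (c * (I.lam i * t)) := by
          rw [ENNReal.tsum_mul_left, I.tsum_law_arrival_lt i ht.le, ENNReal.ofReal_mul hc]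
  rw [value, one_div, inv_mul_le_iff₀ ht]
  linarith

theorem longRunValue_le {i : I.T} {c : ℝ} (hc : 0 ≤ c) (hr0 : ∀ j l, 0 ≤ I.r j l)
    (hr1 : ∀ j l, j ≠ i → I.r j l = 0) (hr : ∀ j, j ≠ i → I.r i j ≤ c)
    (hri : I.r i i * I.lam i ≤ c * I.mu i) : π.longRunValue ≤ c * I.lam i := by
  refine limsup_le_of_le ?_ ?_
  -- A real `limsup` is meaningful here only because the values are bounded below.
  · refine IsBoundedUnder.isCoboundedUnder_le ⟨0, ?_⟩
    rw [eventually_map]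
    filter_upwards [eventually_gt_atTop 0] with t ht using π.value_nonneg hr0 ht
  · filter_upwards [eventually_gt_atTop 0] with t ht using π.value_le hc hr0 hr1 hr hri ht

end OnlinePolicy

/-! ### Overlaps of periods of presence -/

/-- The next agent of the same type arrives before `a` departs. -/
def Overlaps (ω : I.Path) (a : I.Agent) : Prop := I.arrival ω (next a) < I.departure ω a

@[fun_prop]
theorem measurable_overlaps (a : I.Agent) : Measurable fun ω => Overlaps ω a := by
  unfold Overlaps
  fun_prop

theorem law_and_overlaps (a : I.Agent) {H : I.Path → Prop} (hm : Measurable H)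
    (hH : ∀ ω g s, H (I.race ω a g s) ↔ H ω) :
    I.law {ω | H ω ∧ Overlaps ω a} =
      ENNReal.ofReal (I.lam a.1 / (I.lam a.1 + I.mu a.1)) * I.law {ω | H ω} := by
  classical
  have := isProbabilityMeasure_expMeasure (add_pos (I.lam_pos a.1) (I.mu_pos a.1))
  have h : DependsOnMin a H := fun ω _ g s g' s' _ _ _ _ _ hg => by rwa [hH] at hg ⊢
  have hms : MeasurableSet {ω | H ω} := measurableSet_setOfPred.2 hm
  unfold Overlaps
  rw [h.law_arrival_lt_departure hm, ← lintegral_indicator_one hms]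
  congr 1
  refine lintegral_congr fun ω => ?_
  by_cases hω : H ω <;> simp [hH, hω]

theorem law_arrival_lt_and_overlaps (a : I.Agent) (t : ℝ) :
    I.law {ω | I.arrival ω a < t ∧ Overlaps ω a} =
      ENNReal.ofReal (I.lam a.1 / (I.lam a.1 + I.mu a.1)) * I.law {ω | I.arrival ω a < t} :=
  law_and_overlaps a (by fun_prop) fun ω g s => by rw [arrival_race]

/-- The two races use different gaps and sojourn times, hence are independent. The square makes the
loss from chains of overlaps of second order. -/
theorem law_overlaps_next_le (a : I.Agent) (t : ℝ) :
    I.law {ω | (I.arrival ω (next a) < t ∧ Overlaps ω a) ∧ Overlaps ω (next a)} ≤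
      ENNReal.ofReal ((I.lam a.1 / (I.lam a.1 + I.mu a.1)) ^ 2) * I.law {ω | I.arrival ω a < t} := by
  have hp : 0 ≤ I.lam a.1 / (I.lam a.1 + I.mu a.1) :=
    div_nonneg (I.lam_pos _).le (add_pos (I.lam_pos _) (I.mu_pos _)).le
  rw [law_and_overlaps (next a) (by fun_prop), pow_two, ENNReal.ofReal_mul hp, mul_assoc,
    ← law_arrival_lt_and_overlaps]
  · refine mul_le_mul_right (measure_mono_ae ?_) _
    filter_upwards [I.ae_regular] with ω hω h
    exact ⟨(hω.arrival_mono a.1 (Nat.lt_succ_self a.2)).trans h.1, h.2⟩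
  · intro ω g s
    unfold Overlaps
    rw [arrival_race, departure_race_of_lt]
    exact fun _ => Nat.lt_succ_self _

/-! ### Waiting for an agent of another type -/

/-- Let `b` be the first agent of its type after the arrival of `a`. If `W` occurs an exponential
time after the arrival of `a`, it competes with the arrival of `b`. -/
theorem law_le_arrival_of_first {a b : I.Agent} (hab : a.1 ≠ b.1) {W : I.Path → ℝ}
    (hW : Measurable W) {ρ : ℝ} (hρ : 0 < ρ) (res : I.Path → ℝ → I.Path)
    (hres : ∀ f : I.Path → ℝ≥0∞, Measurable f →
      ∫⁻ ω, f ω ∂I.law = ∫⁻ ω, ∫⁻ x, f (res ω x) ∂expMeasure ρ ∂I.law)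
    (ha : ∀ ω x, I.arrival (res ω x) a = I.arrival ω a)
    (hb : ∀ ω x, I.previousArrival (res ω x) b = I.previousArrival ω b)
    (hWres : ∀ ω x, W (res ω x) = I.arrival ω a + x)
    (hWb : ∀ ω g, W (I.setGap ω b g) = W ω) (t : ℝ) :
    I.law {ω | (I.arrival ω a < t ∧ I.previousArrival ω b ≤ I.arrival ω a) ∧
        W ω ≤ I.arrival ω b} ≤
      ENNReal.ofReal (ρ / (ρ + I.lam b.1)) * I.law {ω | (I.arrival ω a < t ∧
        I.previousArrival ω b ≤ I.arrival ω a) ∧ I.arrival ω a < I.arrival ω b} := by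
  classical
  have hl := I.lam_pos b.1
  have hms1 : MeasurableSet {ω | (I.arrival ω a < t ∧ I.previousArrival ω b ≤ I.arrival ω a) ∧
      W ω ≤ I.arrival ω b} := measurableSet_setOfPred.2 (by fun_prop)
  have hms2 : MeasurableSet {ω | (I.arrival ω a < t ∧ I.previousArrival ω b ≤ I.arrival ω a) ∧
      I.arrival ω a < I.arrival ω b} := measurableSet_setOfPred.2 (by fun_prop)
  have hab' : ∀ ω g, I.arrival (I.setGap ω b g) a = I.arrival ω a :=
    fun ω g => arrival_setGap_of_lt I ω g fun e => absurd e hab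
  have hpb : ∀ ω g, I.previousArrival (I.setGap ω b g) b = I.previousArrival ω b :=
    fun ω g => previousArrival_setGap I ω g fun _ => le_rfl
  have hF : Measurable fun ω => ∫⁻ g, Set.indicator {ω | (I.arrival ω a < t ∧
      I.previousArrival ω b ≤ I.arrival ω a) ∧ W ω ≤ I.arrival ω b} 1 (I.setGap ω b g)
      ∂expMeasure (I.lam b.1) :=
    Measurable.lintegral_prod_right' (f := fun p : I.Path × ℝ => Set.indicator {ω |
      (I.arrival ω a < t ∧ I.previousArrival ω b ≤ I.arrival ω a) ∧ W ω ≤ I.arrival ω b} 1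
      (I.setGap p.1 b p.2)) ((measurable_one.indicator hms1).comp (by fun_prop))
  have hG : Measurable fun ω => ∫⁻ g, Set.indicator {ω | (I.arrival ω a < t ∧
      I.previousArrival ω b ≤ I.arrival ω a) ∧ I.arrival ω a < I.arrival ω b} (1 : I.Path → ℝ≥0∞)
      (I.setGap ω b g) ∂expMeasure (I.lam b.1) :=
    Measurable.lintegral_prod_right' (f := fun p : I.Path × ℝ => Set.indicator {ω |
      (I.arrival ω a < t ∧ I.previousArrival ω b ≤ I.arrival ω a) ∧
      I.arrival ω a < I.arrival ω b} 1
      (I.setGap p.1 b p.2)) ((measurable_one.indicator hms2).comp (by fun_prop))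
  rw [← lintegral_indicator_one hms1, ← lintegral_indicator_one hms2,
    I.lintegral_setGap b (measurable_one.indicator hms1),
    I.lintegral_setGap b (measurable_one.indicator hms2), hres _ hF,
    ← lintegral_const_mul _ hG]
  refine lintegral_mono fun ω => ?_
  rw [← lintegral_expMeasure_Ioi hρ hl]
  by_cases hH : I.arrival ω a < t ∧ I.previousArrival ω b ≤ I.arrival ω a
  -- The gap before `b` must exceed the part elapsed when `a` arrives, plus `x`; memorylessness
  -- splits the probability into two factors.
  · have e1 : ∀ x, 0 < x → ∫⁻ g, Set.indicator {ω | (I.arrival ω a < t ∧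
        I.previousArrival ω b ≤ I.arrival ω a) ∧ W ω ≤ I.arrival ω b} 1
        (I.setGap (res ω x) b g) ∂expMeasure (I.lam b.1) =
        expMeasure (I.lam b.1) (Set.Ioi x) *
          expMeasure (I.lam b.1) (Set.Ioi (I.arrival ω a - I.previousArrival ω b)) := by
      intro x hx
      rw [← expMeasure_Ici_add hl hx.le (sub_nonneg.2 hH.2),
        ← lintegral_indicator_one measurableSet_Ici]
      refine lintegral_congr fun g => ?_
      have : W (I.setGap (res ω x) b g) ≤ I.arrival (I.setGap (res ω x) b g) b ↔
          x + (I.arrival ω a - I.previousArrival ω b) ≤ g := by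
        rw [hWb, hWres, arrival_setGap, hb]
        constructor <;> intro h <;> linarith
      simp only [Set.indicator_apply, Set.mem_ofPred_eq, this, Set.mem_Ici, hab', hpb, ha, hb, hH,
        and_self, true_and, Pi.one_apply]
    have e2 : ∫⁻ g, Set.indicator {ω | (I.arrival ω a < t ∧
        I.previousArrival ω b ≤ I.arrival ω a) ∧ I.arrival ω a < I.arrival ω b}
        (1 : I.Path → ℝ≥0∞) (I.setGap ω b g) ∂expMeasure (I.lam b.1) =
          expMeasure (I.lam b.1) (Set.Ioi (I.arrival ω a - I.previousArrival ω b)) := by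
      rw [← lintegral_indicator_one measurableSet_Ioi]
      refine lintegral_congr fun g => ?_
      have : I.arrival ω a < I.arrival (I.setGap ω b g) b ↔
          I.arrival ω a - I.previousArrival ω b < g := by
        rw [arrival_setGap]
        constructor <;> intro h <;> linarith
      simp only [Set.indicator_apply, Set.mem_ofPred_eq, this, Set.mem_Ioi, hab', hpb, hH,
        and_self, true_and, Pi.one_apply]
    rw [e2, ← lintegral_mul_const' _ _
      (by have := isProbabilityMeasure_expMeasure hl; exact measure_ne_top _ _)]
    refine lintegral_mono_ae ?_
    filter_upwards [ae_pos_expMeasure ρ hρ] with x hx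
    rw [e1 x hx]
  · simp only [Set.indicator_apply, Set.mem_ofPred_eq, hab', hpb, ha, hb, hH, false_and,
      if_false, lintegral_zero]
    exact zero_le

/-- The agent `b` is the first agent of its type to arrive after `a`. -/
def FirstAfter (ω : I.Path) (a b : I.Agent) : Prop :=
  I.previousArrival ω b ≤ I.arrival ω a ∧ I.arrival ω a < I.arrival ω b

@[fun_prop]
theorem measurable_firstAfter (a b : I.Agent) : Measurable fun ω => FirstAfter ω a b := by
  unfold FirstAfter
  fun_prop

theorem FirstAfter.unique {ω : I.Path} (hω : I.Regular ω) {a : I.Agent} {j : I.T} {l l' : ℕ}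
    (h : FirstAfter ω a (j, l)) (h' : FirstAfter ω a (j, l')) : l = l' := by
  have key : ∀ l l', FirstAfter ω a (j, l) → FirstAfter ω a (j, l') → ¬ l < l' := by
    intro l l' h h' hlt
    obtain ⟨m, rfl⟩ : ∃ m, l' = m + 1 := ⟨l' - 1, by omega⟩
    have h1 : I.arrival ω (j, m) ≤ I.arrival ω a := h'.1
    have h2 := (hω.arrival_mono j).monotone (Nat.le_of_lt_succ hlt)
    exact absurd (h.2.trans_le (h2.trans h1)) (lt_irrefl _)
  exact le_antisymm (not_lt.1 (key l' l h' h)) (not_lt.1 (key l l' h h'))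

theorem exists_firstAfter {ω : I.Path} (hω : I.Regular ω) (a : I.Agent) (j : I.T) :
    ∃ l, FirstAfter ω a (j, l) := by
  classical
  have hex : ∃ l, I.arrival ω a < I.arrival ω (j, l) := ((hω.2 j).eventually_gt_atTop _).exists
  refine ⟨Nat.find hex, ?_, Nat.find_spec hex⟩
  rcases h : Nat.find hex with _ | m
  · rw [previousArrival_zero]; exact (hω.arrival_pos a).le
  · exact not_lt.1 (Nat.find_min hex (h ▸ Nat.lt_succ_self m))

/-- Summation over the possible identity of the first agent of type `j` after `a`: the events on the
right of `h` are almost surely disjoint by `FirstAfter.unique`. -/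
theorem law_exists_first_late_le {a : I.Agent} {j : I.T} {W : I.Path → ℝ}
    {q : ℝ≥0∞} (t : ℝ)
    (h : ∀ l, I.law {ω | (I.arrival ω a < t ∧ I.previousArrival ω (j, l) ≤ I.arrival ω a) ∧
        W ω ≤ I.arrival ω (j, l)} ≤ q * I.law {ω | (I.arrival ω a < t ∧
        I.previousArrival ω (j, l) ≤ I.arrival ω a) ∧ I.arrival ω a < I.arrival ω (j, l)}) :
    I.law {ω | ∃ l, (I.arrival ω a < t ∧ I.previousArrival ω (j, l) ≤ I.arrival ω a) ∧
        W ω ≤ I.arrival ω (j, l)} ≤ q * I.law {ω | I.arrival ω a < t} := by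
  rw [Set.ofPred_exists]
  refine (measure_iUnion_le _).trans ((ENNReal.tsum_le_tsum h).trans ?_)
  rw [ENNReal.tsum_mul_left, ← measure_iUnion₀]
  · gcongr
    exact Set.iUnion_subset fun l ω hω => hω.1.1
  · intro l l' hne
    refine measure_mono_null ?_ (ae_iff.1 I.ae_regular)
    rintro ω ⟨⟨⟨-, h1⟩, h2⟩, ⟨-, h3⟩, h4⟩ hω
    exact hne (FirstAfter.unique hω ⟨h1, h2⟩ ⟨h3, h4⟩)
  · exact fun k => (measurableSet_setOfPred.2 (by fun_prop)).nullMeasurableSet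

theorem law_next_le_first {i j : I.T} (hij : i ≠ j) (k : ℕ) (t : ℝ) :
    I.law {ω | ∃ l, (I.arrival ω (i, k) < t ∧
        I.previousArrival ω (j, l) ≤ I.arrival ω (i, k)) ∧
        I.arrival ω (next (i, k)) ≤ I.arrival ω (j, l)} ≤
      ENNReal.ofReal (I.lam i / (I.lam i + I.lam j)) * I.law {ω | I.arrival ω (i, k) < t} := by
  refine law_exists_first_late_le t fun l => ?_
  refine law_le_arrival_of_first hij (by fun_prop) (I.lam_pos i)
    (fun ω g => I.setGap ω (next (i, k)) g) (fun f hf => I.lintegral_setGap (next (i, k)) hf)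
    (fun ω x => arrival_setGap_of_lt I ω x fun _ => Nat.lt_succ_self _)
    (fun ω x => previousArrival_setGap I ω x fun e => absurd e.symm hij)
    (fun ω x => arrival_setGap I ω _ x)
    (fun ω g => arrival_setGap_of_lt I ω g fun e => absurd e hij) t

theorem law_departure_le_first {i j : I.T} (hij : i ≠ j) (k : ℕ) (t : ℝ) :
    I.law {ω | ∃ l, (I.arrival ω (i, k) < t ∧
        I.previousArrival ω (j, l) ≤ I.arrival ω (i, k)) ∧
        I.departure ω (i, k) ≤ I.arrival ω (j, l)} ≤
      ENNReal.ofReal (I.mu i / (I.mu i + I.lam j)) * I.law {ω | I.arrival ω (i, k) < t} := by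
  refine law_exists_first_late_le t fun l => ?_
  refine law_le_arrival_of_first hij (by fun_prop) (I.mu_pos i)
    (fun ω g => I.setSojourn ω (i, k) g) (fun f hf => I.lintegral_setSojourn (i, k) hf)
    (fun ω x => arrival_setSojourn I ω _ _ x) (fun ω x => previousArrival_setSojourn I ω _ _ x)
    (fun ω x => departure_setSojourn I ω _ x)
    (fun ω g => departure_setGap_of_lt I ω g fun e => absurd e hij) t

/-! ### A local matching rule -/

theorem Regular.finite_arrival_lt {ω : I.Path} (hω : I.Regular ω) (t : ℝ) :
    {a : I.Agent | I.arrival ω a < t}.Finite := by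
  have h : ∀ i : I.T, {k : ℕ | I.arrival ω (i, k) < t}.Finite := by
    intro i
    have h1 := (hω.2 i).eventually_ge_atTop t
    rw [← Nat.cofinite_eq_atTop, eventually_cofinite] at h1
    simpa only [not_le] using h1
  refine (Set.finite_iUnion fun i => (h i).image (Prod.mk i)).subset ?_
  rintro ⟨i, k⟩ hik
  exact Set.mem_iUnion.2 ⟨i, k, hik, rfl⟩

/-- The preceding agent of the same type departs before `a` arrives. -/
def Isolated (ω : I.Path) (a : I.Agent) : Prop := ∀ l, l + 1 = a.2 → ¬ Overlaps ω (a.1, l)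

/-- `a` should be matched with the next agent of its type. -/
def PairsWithNext (t : ℝ) (ω : I.Path) (a : I.Agent) : Prop :=
  Isolated ω a ∧ Overlaps ω a ∧ I.arrival ω (next a) < t

/-- `a` should be matched with `b`, the first agent of another type to arrive after `a`. -/
def PairsWithFirst (t : ℝ) (ω : I.Path) (a b : I.Agent) : Prop :=
  Isolated ω a ∧ ¬ (Overlaps ω a ∧ I.arrival ω (next a) < t) ∧ FirstAfter ω a b ∧
    I.arrival ω b < I.departure ω a ∧ I.arrival ω b < I.arrival ω (next a) ∧ I.arrival ω b < t

/-- The pairs matched by a rule that prefers pairs of agents of type `i` to pairs of an agent of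
type `i` with a later one of type `j`. -/
def LocalPair (i j : I.T) (t : ℝ) (ω : I.Path) (p : I.Agent × I.Agent) : Prop :=
  p.1.1 = i ∧ (p.2 = next p.1 ∧ PairsWithNext t ω p.1 ∨ p.2.1 = j ∧ PairsWithFirst t ω p.1 p.2)

@[fun_prop]
theorem measurable_isolated (a : I.Agent) : Measurable fun ω => Isolated ω a := by
  unfold Isolated
  fun_prop

@[fun_prop]
theorem measurable_pairsWithNext (t : ℝ) (a : I.Agent) :
    Measurable fun ω => PairsWithNext t ω a := by
  unfold PairsWithNext
  fun_prop

@[fun_prop]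
theorem measurable_pairsWithFirst (t : ℝ) (a b : I.Agent) :
    Measurable fun ω => PairsWithFirst t ω a b := by
  unfold PairsWithFirst
  fun_prop

@[fun_prop]
theorem measurable_localPair (i j : I.T) (t : ℝ) (p : I.Agent × I.Agent) :
    Measurable fun ω => LocalPair i j t ω p := by
  unfold LocalPair
  fun_prop

theorem LocalPair.spec {i j : I.T} {t : ℝ} {ω : I.Path} (hω : I.Regular ω)
    {p : I.Agent × I.Agent} (h : LocalPair i j t ω p) :
    I.arrival ω p.1 < I.arrival ω p.2 ∧ I.arrival ω p.2 < t ∧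
      I.arrival ω p.2 < I.departure ω p.1 := by
  obtain ⟨a, b⟩ := p
  rcases h with ⟨-, ⟨h, h1⟩ | ⟨h, h1⟩⟩
  · simp only at h
    subst h
    exact ⟨hω.arrival_mono a.1 (Nat.lt_succ_self a.2), h1.2.2, h1.2.1⟩
  · exact ⟨h1.2.2.1.2, h1.2.2.2.2.2, h1.2.2.2.1⟩

theorem LocalPair.edge {i j : I.T} {t : ℝ} {ω : I.Path} (hω : I.Regular ω)
    {p : I.Agent × I.Agent} (h : LocalPair i j t ω p) : I.Edge t ω p.1 p.2 := by
  obtain ⟨h1, h2, h3⟩ := h.spec hω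
  refine ⟨fun e => ?_, h1.trans h2, h2, I.arrival ω p.2, ⟨h1.le, h3.le⟩, le_rfl,
    (hω.arrival_lt_departure _).le⟩
  rw [e] at h1
  exact lt_irrefl _ h1

theorem localPair_finite {i j : I.T} {t : ℝ} {ω : I.Path} (hω : I.Regular ω) :
    {p | LocalPair i j t ω p}.Finite := by
  refine ((hω.finite_arrival_lt t).prod (hω.finite_arrival_lt t)).subset fun p hp => ?_
  obtain ⟨h1, h2, -⟩ := LocalPair.spec hω hp
  exact ⟨h1.trans h2, h2⟩

/-- An agent paired with its successor overlaps it, so the successor is not `Isolated` and starts no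
pair; an agent starting a pair is `Isolated`, so it is no one's paired successor. A partner of type
`j` arrives before the next agent of type `i`, so it determines the agent it is paired with. -/
theorem LocalPair.matching {i j : I.T} (hij : i ≠ j) {t : ℝ} {ω : I.Path} (hω : I.Regular ω)
    {p q : I.Agent × I.Agent} (hp : LocalPair i j t ω p) (hq : LocalPair i j t ω q) (hpq : p ≠ q) :
    p.1 ≠ q.1 ∧ p.1 ≠ q.2 ∧ p.2 ≠ q.1 ∧ p.2 ≠ q.2 := by
  obtain ⟨⟨i1, k⟩, j1, l⟩ := p
  obtain ⟨⟨i2, k'⟩, j2, l'⟩ := q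
  obtain ⟨h1, h2⟩ := hp
  obtain ⟨h3, h4⟩ := hq
  simp only at h1 h2 h3 h4
  subst h1
  subst h3
  rcases h2 with ⟨h2, hp⟩ | ⟨rfl, hp⟩ <;> rcases h4 with ⟨h4, hq⟩ | ⟨h4, hq⟩
  · simp only [Prod.mk.injEq] at h2 h4
    obtain ⟨rfl, rfl⟩ := h2
    obtain ⟨rfl, rfl⟩ := h4
    have hk : k ≠ k' := by rintro rfl; exact hpq rfl
    have e1 : k ≠ k' + 1 := fun e => hp.1 k' e.symm hq.2.1
    have e2 : k + 1 ≠ k' := fun e => hq.1 k e hp.2.1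
    simp only [ne_eq, Prod.mk.injEq, true_and]
    omega
  · subst h4
    simp only [Prod.mk.injEq] at h2
    obtain ⟨rfl, rfl⟩ := h2
    have e1 : k ≠ k' := by rintro rfl; exact hq.2.1 hp.2
    have e2 : k + 1 ≠ k' := fun e => hq.1 k e hp.2.1
    simp [hij, e1, e2]
  · simp only [Prod.mk.injEq] at h4
    obtain ⟨rfl, rfl⟩ := h4
    have e1 : k ≠ k' := by rintro rfl; exact hp.2.1 hq.2
    have e2 : k ≠ k' + 1 := fun e => hp.1 k' e.symm hq.2.1
    simp [hij.symm, e1, e2]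
  · subst h4
    have hm := hω.arrival_mono j2
    have hmi := hω.arrival_mono i2
    have e1 : k ≠ k' := by
      rintro rfl
      exact hpq (by rw [FirstAfter.unique hω hp.2.2.1 hq.2.2.1])
    have e2 : l ≠ l' := by
      rintro rfl
      rcases lt_or_gt_of_ne e1 with h | h
      · have : I.arrival ω (next (i2, k)) ≤ I.arrival ω (i2, k') :=
          hmi.monotone (Nat.succ_le_of_lt h)
        exact absurd (hp.2.2.2.2.1.trans_le this) (not_lt.2 hq.2.2.1.2.le)
      · have : I.arrival ω (next (i2, k')) ≤ I.arrival ω (i2, k) :=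
          hmi.monotone (Nat.succ_le_of_lt h)
        exact absurd (hq.2.2.2.2.1.trans_le this) (not_lt.2 hp.2.2.1.2.le)
    simp [hij, hij.symm, e1, e2]

/-- The rule consults a successor only if it arrives before `t`, and the other agents it consults
arrive before `t` as well. -/
theorem LocalPair.history {i j : I.T} {t : ℝ} {ω ω' : I.Path} (hω : I.Regular ω)
    (h : I.SameHistory t ω ω') {p : I.Agent × I.Agent}
    (hp : LocalPair i j t ω p) : LocalPair i j t ω' p := by
  obtain ⟨h1, h2, -⟩ := hp.spec hω
  obtain ⟨a, b⟩ := p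
  obtain ⟨hi, hp⟩ := hp
  simp only at h1 h2 hi hp
  obtain ⟨ea, eda⟩ := h a (Or.inl (h1.trans h2))
  obtain ⟨eb, -⟩ := h b (Or.inl h2)
  have hiso : Isolated ω a → Isolated ω' a := by
    intro hI l hl hO
    have hlt : I.arrival ω (a.1, l) < I.arrival ω a := by
      have := hω.arrival_mono a.1 (show l < a.2 by omega)
      simpa using this
    have hnext : (next (a.1, l) : I.Agent) = a := Prod.ext rfl hl
    apply hI l hl
    unfold Overlaps at hO ⊢
    rw [hnext] at hO ⊢
    rwa [(h _ (Or.inl (hlt.trans (h1.trans h2)))).2, ea]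
  refine ⟨hi, ?_⟩
  rcases hp with ⟨rfl, hI, hO, -⟩ | ⟨hj, hI, hO, hF, hd, hn, -⟩
  · refine Or.inl ⟨rfl, hiso hI, ?_, by rwa [← eb]⟩
    unfold Overlaps at hO ⊢
    rwa [← eb, ← eda]
  · refine Or.inr ⟨hj, hiso hI, ?_, ⟨?_, by rwa [← ea, ← eb]⟩, by rwa [← eda, ← eb], ?_,
      by rwa [← eb]⟩
    · rintro ⟨hO', hlt⟩
      have e := (h (next a) (Or.inr hlt)).1
      refine hO ⟨?_, by rwa [e]⟩
      unfold Overlaps at hO' ⊢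
      rwa [e, eda]
    · obtain ⟨jb, l⟩ := b
      rcases l with _ | m
      · simpa only [previousArrival_zero, ← ea] using hF.1
      · have hm : I.arrival ω (jb, m) ≤ I.arrival ω a := hF.1
        have e := (h (jb, m) (Or.inl (hm.trans_lt (h1.trans h2)))).1
        change I.arrival ω' (jb, m) ≤ I.arrival ω' a
        rwa [← e, ← ea]
    -- A successor outside the history arrives at or after `t`, hence after `b` in any case.
    · rcases lt_or_ge (I.arrival ω' (next a)) t with hlt | hge
      · rwa [← (h (next a) (Or.inr hlt)).1, ← eb]
      · rw [← eb]; exact h2.trans_le hge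

open Classical in
/-- The local matching rule as a policy without informational constraints. -/
def localPolicy (i j : I.T) (hij : i ≠ j) : I.OmnisPolicy where
  choose t ω := if h : {p | LocalPair i j t ω p}.Finite then h.toFinset else ∅
  edge t ω hω p hp := by
    rw [dif_pos (localPair_finite hω), Set.Finite.mem_toFinset] at hp
    exact ⟨LocalPair.edge hω hp, (LocalPair.spec hω hp).1⟩
  matching t ω hω p hp q hq hpq := by
    rw [dif_pos (localPair_finite hω), Set.Finite.mem_toFinset] at hp hq
    exact LocalPair.matching hij hω hp hq hpq
  history t ω ω' hω hω' h := by
    rw [dif_pos (localPair_finite hω), dif_pos (localPair_finite hω')]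
    ext p
    simp only [Set.Finite.mem_toFinset]
    refine ⟨fun hp => LocalPair.history hω h hp, fun hp => LocalPair.history hω' (fun a ha => ?_) hp⟩
    obtain ⟨h1, h2⟩ := h a ha.symm
    exact ⟨h1.symm, h2.symm⟩
  measurable t p := by
    -- Finiteness is rewritten as a quantifier over the countable type of finsets, which makes the
    -- event measurable.
    have h : ∀ ω, p ∈ (if h : {p | LocalPair i j t ω p}.Finite then h.toFinset else ∅) ↔
        LocalPair i j t ω p ∧ ∃ F : Finset (I.Agent × I.Agent), ∀ q, LocalPair i j t ω q → q ∈ F := by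
      intro ω
      by_cases hf : {p | LocalPair i j t ω p}.Finite
      · rw [dif_pos hf, Set.Finite.mem_toFinset]
        exact ⟨fun hp => ⟨hp, hf.toFinset, fun q hq => hf.mem_toFinset.2 hq⟩, fun hp => hp.1⟩
      · rw [dif_neg hf]
        refine ⟨fun hp => absurd hp (Finset.notMem_empty p), fun ⟨_, F, hF⟩ => ?_⟩
        exact absurd (F.finite_toSet.subset hF) hf
    simp only [h]
    exact measurableSet_setOfPred.2 (by fun_prop)

theorem mem_localPolicy_choose {i j : I.T} (hij : i ≠ j) (t : ℝ) {ω : I.Path} (hω : I.Regular ω)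
    (p : I.Agent × I.Agent) : p ∈ (localPolicy i j hij).choose t ω ↔ LocalPair i j t ω p := by
  simp [localPolicy, dif_pos (localPair_finite hω)]

/-! ### Bounds on the omniscient value -/

theorem OmnisPolicy.lintegral_reward (π : I.OmnisPolicy) (hr : ∀ i j, 0 ≤ I.r i j) (t : ℝ) :
    ∫⁻ ω, ENNReal.ofReal (∑ p ∈ π.choose t ω, I.r p.1.1 p.2.1) ∂I.law =
      ∑' p : I.Agent × I.Agent, ENNReal.ofReal (I.r p.1.1 p.2.1) *
        I.law {ω | p ∈ π.choose t ω} := by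
  classical
  have h : ∀ ω, ENNReal.ofReal (∑ p ∈ π.choose t ω, I.r p.1.1 p.2.1) =
      ∑' p : I.Agent × I.Agent, ENNReal.ofReal (I.r p.1.1 p.2.1) *
        Set.indicator {ω | p ∈ π.choose t ω} 1 ω := by
    intro ω
    rw [ENNReal.ofReal_sum_of_nonneg fun p _ => hr _ _, tsum_eq_sum (s := π.choose t ω)]
    · refine Finset.sum_congr rfl fun p hp => ?_
      simp [hp]
    · intro p hp
      simp [hp]
  simp only [h]
  rw [lintegral_tsum fun p =>
    ((measurable_one.indicator (π.measurable t p)).const_mul _).aemeasurable]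
  refine tsum_congr fun p => ?_
  rw [lintegral_const_mul _ (measurable_one.indicator (π.measurable t p)),
    lintegral_indicator_one (π.measurable t p)]

theorem OmnisPolicy.tsum_law_choose_le (π : I.OmnisPolicy) (t : ℝ) (a : I.Agent) :
    ∑' b, I.law {ω | (a, b) ∈ π.choose t ω} ≤ I.law {ω | I.arrival ω a < t} := by
  rw [← measure_iUnion₀]
  · refine measure_mono_ae ?_
    filter_upwards [I.ae_regular] with ω hω h
    obtain ⟨b, hb⟩ := Set.mem_iUnion.1 h
    exact (π.edge t ω hω _ hb).1.2.1
  · intro b b' hne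
    refine measure_mono_null ?_ (ae_iff.1 I.ae_regular)
    rintro ω ⟨h1, h2⟩ hω
    exact (π.matching t ω hω _ h1 _ h2 fun e => hne (congrArg Prod.snd e)).1 rfl
  · exact fun b => (π.measurable t (a, b)).nullMeasurableSet

theorem OmnisPolicy.lintegral_reward_le (π : I.OmnisPolicy) (hr : ∀ i j, 0 ≤ I.r i j) {R : ℝ}
    (hR : ∀ i j, I.r i j ≤ R) (hR0 : 0 ≤ R) {t : ℝ} (ht : 0 ≤ t) :
    ∫⁻ ω, ENNReal.ofReal (∑ p ∈ π.choose t ω, I.r p.1.1 p.2.1) ∂I.law ≤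
      ENNReal.ofReal (R * ((∑ i, I.lam i) * t)) := by
  rw [π.lintegral_reward hr, ENNReal.tsum_prod', ENNReal.ofReal_mul hR0, Finset.sum_mul,
    ENNReal.ofReal_sum_of_nonneg fun i _ => mul_nonneg (I.lam_pos i).le ht, Finset.mul_sum,
    ENNReal.tsum_prod', tsum_fintype]
  refine Finset.sum_le_sum fun i _ => ?_
  rw [← I.tsum_law_arrival_lt i ht, ← ENNReal.tsum_mul_left]
  refine ENNReal.tsum_le_tsum fun k => ?_
  refine le_trans ?_ (mul_le_mul_right (π.tsum_law_choose_le t (i, k)) _)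
  rw [← ENNReal.tsum_mul_left]
  refine ENNReal.tsum_le_tsum fun b => ?_
  gcongr
  exact hR _ _

/-- A crude bound (each agent comes first in at most one pair), needed so that the supremum and the
`liminf` in `off` are genuine rather than default values. -/
theorem OmnisPolicy.value_le (π : I.OmnisPolicy) (hr : ∀ i j, 0 ≤ I.r i j) {R : ℝ}
    (hR : ∀ i j, I.r i j ≤ R) (hR0 : 0 ≤ R) {t : ℝ} (ht : 0 < t) :
    π.value t ≤ R * ∑ i, I.lam i := by
  have hl : 0 ≤ ∑ i, I.lam i := Finset.sum_nonneg fun i _ => (I.lam_pos i).le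
  have h := integral_le_of_lintegral_ofReal_le (fun ω => Finset.sum_nonneg fun p _ => hr _ _)
    (by positivity) (π.lintegral_reward_le hr hR hR0 ht.le)
  rw [value, one_div, inv_mul_le_iff₀ ht]
  linarith

theorem OmnisPolicy.integral_reward (π : I.OmnisPolicy) (hr : ∀ i j, 0 ≤ I.r i j) (t : ℝ) :
    ∫ ω, ∑ p ∈ π.choose t ω, I.r p.1.1 p.2.1 ∂I.law =
      (∑' p : I.Agent × I.Agent, ENNReal.ofReal (I.r p.1.1 p.2.1) *
        I.law {ω | p ∈ π.choose t ω}).toReal := by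
  classical
  rw [← π.lintegral_reward hr, integral_eq_lintegral_of_nonneg_ae]
  · exact .of_forall fun ω => Finset.sum_nonneg fun p _ => hr _ _
  · have h : ∀ ω, ∑ p ∈ π.choose t ω, I.r p.1.1 p.2.1 =
        (∑' p : I.Agent × I.Agent, ENNReal.ofReal (I.r p.1.1 p.2.1) *
          Set.indicator {ω | p ∈ π.choose t ω} 1 ω).toReal := by
      intro ω
      rw [tsum_eq_sum (s := π.choose t ω) fun p hp => by simp [hp],
        ← ENNReal.toReal_ofReal (Finset.sum_nonneg fun p _ => hr p.1.1 p.2.1),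
        ENNReal.ofReal_sum_of_nonneg fun p _ => hr _ _]
      congr 1
      refine Finset.sum_congr rfl fun p hp => ?_
      simp [hp]
    simp only [h]
    exact (Measurable.tsum fun p => (measurable_one.indicator
      (π.measurable t p)).const_mul _).ennreal_toReal.aestronglyMeasurable

/-- The event for `k = 0` is empty. This shift charges a conflict with the preceding agent to that
agent. -/
theorem tsum_law_exists_pred (H : ℕ → I.Path → Prop) :
    ∑' k, I.law {ω | ∃ l, l + 1 = k ∧ H l ω} = ∑' l, I.law {ω | H l ω} := by
  rw [tsum_eq_zero_add' ENNReal.summable]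
  simp

/-- An overlapping agent is paired with its successor unless its predecessor overlaps it, or it is
the last arrival of its type before `t`. -/
theorem tsum_law_overlaps_le (i : I.T) (t : ℝ) :
    ∑' k, I.law {ω | I.arrival ω (i, k) < t ∧ Overlaps ω (i, k)} ≤
      ∑' k, I.law {ω | PairsWithNext t ω (i, k)} +
      ∑' k, I.law {ω | (I.arrival ω (next (i, k)) < t ∧ Overlaps ω (i, k)) ∧
        Overlaps ω (next (i, k))} + 1 := by
  rw [← tsum_law_exists_pred fun k ω => (I.arrival ω (next (i, k)) < t ∧ Overlaps ω (i, k)) ∧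
        Overlaps ω (next (i, k))]
  refine le_trans ?_ (add_le_add_right (I.tsum_law_arrival_lt_le_one i t) _)
  rw [← ENNReal.tsum_add, ← ENNReal.tsum_add]
  refine ENNReal.tsum_le_tsum fun k => ?_
  refine le_trans (measure_mono ?_) ((measure_union_le _ _).trans
    (add_le_add_left (measure_union_le _ _) _))
  rintro ω ⟨h1, h2⟩
  by_cases h3 : I.arrival ω (next (i, k)) < t
  · refine Or.inl ?_
    by_cases h4 : Isolated ω (i, k)
    · exact Or.inl ⟨h4, h2, h3⟩
    · unfold Isolated at h4
      push Not at h4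
      obtain ⟨l, rfl, hl⟩ := h4
      exact Or.inr ⟨l, rfl, ⟨h1, hl⟩, h2⟩
  · exact Or.inr ⟨h1, not_lt.1 h3⟩

/-- The terms exhaust the obstacles to a match with the first later agent of type `j`: overlapping
the successor, being overlapped by the predecessor, the successor or the departure coming too soon,
and the horizon. -/
theorem tsum_law_arrival_le (i j : I.T) (t : ℝ) :
    ∑' k, I.law {ω | I.arrival ω (i, k) < t} ≤
      ∑' k, I.law {ω | ∃ l, PairsWithFirst t ω (i, k) (j, l)} +
      ∑' k, I.law {ω | I.arrival ω (i, k) < t ∧ Overlaps ω (i, k)} +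
      ∑' k, I.law {ω | I.arrival ω (next (i, k)) < t ∧ Overlaps ω (i, k)} +
      ∑' k, I.law {ω | ∃ l, (I.arrival ω (i, k) < t ∧
        I.previousArrival ω (j, l) ≤ I.arrival ω (i, k)) ∧
        I.arrival ω (next (i, k)) ≤ I.arrival ω (j, l)} +
      ∑' k, I.law {ω | ∃ l, (I.arrival ω (i, k) < t ∧
        I.previousArrival ω (j, l) ≤ I.arrival ω (i, k)) ∧
        I.departure ω (i, k) ≤ I.arrival ω (j, l)} + 1 := by
  rw [← tsum_law_exists_pred fun k ω => I.arrival ω (next (i, k)) < t ∧ Overlaps ω (i, k)]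
  refine le_trans ?_ (add_le_add_right (I.tsum_law_arrival_lt_le_one i t) _)
  simp only [← ENNReal.tsum_add]
  refine ENNReal.tsum_le_tsum fun k => ?_
  refine le_trans (measure_mono_ae ?_) ((measure_union_le _ _).trans (add_le_add_left
    ((measure_union_le _ _).trans (add_le_add_left ((measure_union_le _ _).trans (add_le_add_left
    ((measure_union_le _ _).trans (add_le_add_left (measure_union_le _ _) _)) _)) _)) _))
  filter_upwards [I.ae_regular] with ω hω h1
  obtain ⟨l, hl⟩ := exists_firstAfter hω (i, k) j
  by_cases h2 : Overlaps ω (i, k)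
  · exact Or.inl <| Or.inl <| Or.inl <| Or.inl <| Or.inr ⟨h1, h2⟩
  by_cases h3 : Isolated ω (i, k)
  swap
  · unfold Isolated at h3
    push Not at h3
    obtain ⟨m, rfl, hm⟩ := h3
    exact Or.inl <| Or.inl <| Or.inl <| Or.inr ⟨m, rfl, h1, hm⟩
  by_cases h4 : I.arrival ω (j, l) < I.arrival ω (next (i, k))
  swap
  · exact Or.inl <| Or.inl <| Or.inr ⟨l, ⟨h1, hl.1⟩, not_lt.1 h4⟩
  by_cases h5 : I.arrival ω (j, l) < I.departure ω (i, k)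
  swap
  · exact Or.inl <| Or.inr ⟨l, ⟨h1, hl.1⟩, not_lt.1 h5⟩
  by_cases h6 : I.arrival ω (j, l) < t
  · exact Or.inl <| Or.inl <| Or.inl <| Or.inl <| Or.inl
      ⟨l, h3, fun h => h2 h.1, hl, h5, h4, h6⟩
  · exact Or.inr ⟨h1, (not_lt.1 h6).trans h4.le⟩

theorem tsum_pairs_le {i j : I.T} (hij : i ≠ j) (t : ℝ) :
    ENNReal.ofReal (I.r i i) * ∑' k, I.law {ω | PairsWithNext t ω (i, k)} +
      ENNReal.ofReal (I.r i j) * ∑' k, I.law {ω | ∃ l, PairsWithFirst t ω (i, k) (j, l)} ≤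
    ∑' p : I.Agent × I.Agent, ENNReal.ofReal (I.r p.1.1 p.2.1) *
        I.law {ω | p ∈ (localPolicy i j hij).choose t ω} := by
  classical
  have hlaw : ∀ p, I.law {ω | p ∈ (localPolicy i j hij).choose t ω} =
      I.law {ω | LocalPair i j t ω p} := by
    intro p
    refine measure_congr ?_
    filter_upwards [I.ae_regular] with ω hω
    exact propext (mem_localPolicy_choose hij t hω p)
  simp only [hlaw]
  rw [ENNReal.tsum_prod', ENNReal.tsum_prod', ← ENNReal.tsum_mul_left, ← ENNReal.tsum_mul_left,
    ← ENNReal.tsum_add]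
  refine le_trans ?_ (ENNReal.le_tsum i)
  refine ENNReal.tsum_le_tsum fun k => ?_
  rw [ENNReal.tsum_prod']
  refine le_trans ?_ (ENNReal.sum_le_tsum {i, j})
  rw [Finset.sum_pair hij]
  refine add_le_add (le_trans ?_ (ENNReal.le_tsum (k + 1))) ?_
  · gcongr
    intro h
    exact ⟨rfl, Or.inl ⟨rfl, h⟩⟩
  · change _ ≤ ∑' l, ENNReal.ofReal (I.r i j) * I.law {ω | LocalPair i j t ω ((i, k), (j, l))}
    rw [ENNReal.tsum_mul_left, Set.ofPred_exists]
    gcongr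
    refine (measure_iUnion_le _).trans (ENNReal.tsum_le_tsum fun l => measure_mono fun ω h => ?_)
    exact ⟨rfl, Or.inr ⟨rfl, h⟩⟩

/-- The long-run reward rate guaranteed by the local matching rule. -/
def localRate (I : MatchingInstance) (i j : I.T) : ℝ :=
  I.lam i * (I.r i i * (I.lam i / (I.lam i + I.mu i) - (I.lam i / (I.lam i + I.mu i)) ^ 2) +
    I.r i j * (1 - 2 * (I.lam i / (I.lam i + I.mu i)) - I.lam i / (I.lam i + I.lam j) -
      I.mu i / (I.mu i + I.lam j)))

/-- The error over `t` comes from the two boundary terms `+ 1`, one for each kind of pair. -/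
theorem localRate_le_value {i j : I.T} (hij : i ≠ j) (hr : ∀ i j, 0 ≤ I.r i j) {R : ℝ}
    (hR : ∀ i j, I.r i j ≤ R) {t : ℝ} (ht : 0 < t) :
    I.localRate i j - (I.r i i + I.r i j) / t ≤ (localPolicy i j hij).value t := by
  have hR0 : 0 ≤ R := (hr i i).trans (hR i i)
  have hli := I.lam_pos i
  have hlj := I.lam_pos j
  have hmi := I.mu_pos i
  set p := I.lam i / (I.lam i + I.mu i) with hp
  set q := I.lam i / (I.lam i + I.lam j) with hq
  set q' := I.mu i / (I.mu i + I.lam j) with hq'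
  have hp0 : 0 ≤ p := by positivity
  have hq0 : 0 ≤ q := by positivity
  have hq0' : 0 ≤ q' := by positivity
  set X := ∑' k, I.law {ω | PairsWithNext t ω (i, k)} with hX
  set Y := ∑' k, I.law {ω | ∃ l, PairsWithFirst t ω (i, k) (j, l)} with hY
  have hA := I.tsum_law_arrival_lt i ht.le
  have hA0 : 0 ≤ I.lam i * t := by positivity
  have hXfin : X ≠ ∞ := by
    refine ne_top_of_le_ne_top (I.tsum_law_arrival_lt_ne_top i ht.le)
      (ENNReal.tsum_le_tsum fun k => measure_mono_ae ?_)
    filter_upwards [I.ae_regular] with ω hω h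
    exact (hω.arrival_mono i (Nat.lt_succ_self k)).trans h.2.2
  have hYfin : Y ≠ ∞ := by
    refine ne_top_of_le_ne_top (I.tsum_law_arrival_lt_ne_top i ht.le)
      (ENNReal.tsum_le_tsum fun k => measure_mono fun ω h => ?_)
    obtain ⟨l, hl⟩ := h
    exact hl.2.2.1.2.trans hl.2.2.2.2.2
  have hOv : ∑' k, I.law {ω | I.arrival ω (i, k) < t ∧ Overlaps ω (i, k)} =
      ENNReal.ofReal (p * (I.lam i * t)) := by
    rw [ENNReal.ofReal_mul hp0, ← hA, ← ENNReal.tsum_mul_left]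
    exact tsum_congr fun k => law_arrival_lt_and_overlaps (i, k) t
  have hX' : p * (I.lam i * t) ≤ X.toReal + p ^ 2 * (I.lam i * t) + 1 := by
    rw [← ENNReal.ofReal_le_ofReal_iff (by positivity), ENNReal.ofReal_add (by positivity)
      zero_le_one, ENNReal.ofReal_add ENNReal.toReal_nonneg (by positivity),
      ENNReal.ofReal_toReal hXfin, ENNReal.ofReal_one, ← hOv]
    refine (tsum_law_overlaps_le i t).trans ?_
    gcongr
    rw [ENNReal.ofReal_mul (by positivity), ← hA, ← ENNReal.tsum_mul_left]
    exact ENNReal.tsum_le_tsum fun k => law_overlaps_next_le (i, k) t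
  have hY' : I.lam i * t ≤ Y.toReal + p * (I.lam i * t) + p * (I.lam i * t) +
      q * (I.lam i * t) + q' * (I.lam i * t) + 1 := by
    rw [← ENNReal.ofReal_le_ofReal_iff (by positivity), ENNReal.ofReal_add (by positivity)
      zero_le_one, ENNReal.ofReal_add (by positivity) (by positivity),
      ENNReal.ofReal_add (by positivity) (by positivity),
      ENNReal.ofReal_add (by positivity) (by positivity),
      ENNReal.ofReal_add ENNReal.toReal_nonneg (by positivity),
      ENNReal.ofReal_toReal hYfin, ENNReal.ofReal_one, ← hOv]
    rw [← hA]
    refine (tsum_law_arrival_le i j t).trans ?_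
    gcongr ?_ + ?_ + ?_ + ?_ + ?_ + _
    · exact le_rfl
    · exact le_rfl
    · refine ENNReal.tsum_le_tsum fun k => measure_mono_ae ?_
      filter_upwards [I.ae_regular] with ω hω h
      exact ⟨(hω.arrival_mono i (Nat.lt_succ_self k)).trans h.1, h.2⟩
    · rw [ENNReal.ofReal_mul hq0, ← hA, ← ENNReal.tsum_mul_left]
      exact ENNReal.tsum_le_tsum fun k => law_next_le_first hij k t
    · rw [ENNReal.ofReal_mul hq0', ← hA, ← ENNReal.tsum_mul_left]
      exact ENNReal.tsum_le_tsum fun k => law_departure_le_first hij k t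
  have hfin : ∑' p : I.Agent × I.Agent, ENNReal.ofReal (I.r p.1.1 p.2.1) *
        I.law {ω | p ∈ (localPolicy i j hij).choose t ω} ≠ ∞ := by
    rw [← OmnisPolicy.lintegral_reward _ hr]
    exact ne_top_of_le_ne_top ENNReal.ofReal_ne_top
      (OmnisPolicy.lintegral_reward_le _ hr hR hR0 ht.le)
  have hmain : I.r i i * X.toReal + I.r i j * Y.toReal ≤
      ∫ ω, ∑ p ∈ (localPolicy i j hij).choose t ω, I.r p.1.1 p.2.1 ∂I.law := by
    rw [OmnisPolicy.integral_reward _ hr]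
    refine le_trans (le_of_eq ?_) (ENNReal.toReal_mono hfin (tsum_pairs_le hij t))
    rw [ENNReal.toReal_add (ENNReal.mul_ne_top ENNReal.ofReal_ne_top hXfin)
      (ENNReal.mul_ne_top ENNReal.ofReal_ne_top hYfin), ENNReal.toReal_mul, ENNReal.toReal_mul,
      ENNReal.toReal_ofReal (hr i i), ENNReal.toReal_ofReal (hr i j)]
  rw [OmnisPolicy.value, one_div, ← div_eq_inv_mul, le_div_iff₀ ht, sub_mul,
    div_mul_cancel₀ _ ht.ne']
  refine le_trans ?_ hmain
  have h1 := mul_le_mul_of_nonneg_left hX' (hr i i)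
  have h2 := mul_le_mul_of_nonneg_left hY' (hr i j)
  unfold localRate
  rw [← hp, ← hq, ← hq']
  linarith

theorem le_off {i j : I.T} (hij : i ≠ j) (hr : ∀ i j, 0 ≤ I.r i j) {R : ℝ}
    (hR : ∀ i j, I.r i j ≤ R) {c : ℝ} (hc : c < I.localRate i j) : c ≤ I.off := by
  have hR0 : 0 ≤ R := (hr i i).trans (hR i i)
  refine le_liminf_of_le ?_ ?_
  · refine IsBoundedUnder.isCoboundedUnder_ge ⟨R * ∑ i, I.lam i, ?_⟩
    rw [eventually_map]
    filter_upwards [eventually_gt_atTop 0] with t ht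
    have : Nonempty I.OmnisPolicy := ⟨localPolicy i j hij⟩
    exact ciSup_le fun π => π.value_le hr hR hR0 ht
  · have h1 : Tendsto (fun t : ℝ => I.localRate i j - (I.r i i + I.r i j) / t) atTop
        (nhds (I.localRate i j - 0)) :=
      tendsto_const_nhds.sub (tendsto_const_nhds.div_atTop tendsto_id)
    rw [sub_zero] at h1
    filter_upwards [eventually_gt_atTop 0, h1.eventually_const_lt hc] with t ht h2
    refine (h2.le.trans (localRate_le_value hij hr hR ht)).trans
      (le_ciSup (f := fun π : I.OmnisPolicy => π.value t) ⟨R * ∑ i, I.lam i, ?_⟩ _)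
    rintro _ ⟨π, rfl⟩
    exact π.value_le hr hR hR0 ht

/-! ### The hard instance -/

/-- Two types with departure rate `1`. Agents of the type `true` are rare: a pair of them is
worth `1 / d`, but while such an agent waits, another one arrives only at rate `d`. Agents of the
type `false` are abundant, and matching one with a waiting agent of the type `true` is worth `1`. -/
def rareCommon (d : ℝ) (hd : 0 < d) : MatchingInstance where
  T := Bool
  lam i := if i then d else 1 / d
  mu _ := 1
  -- An abundant agent matched with a later one earns nothing, so every reward can be charged to an
  -- earlier rare agent.
  r i j := if i then (if j then 1 / d else 1) else 0
  lam_pos i := by cases i <;> simp [hd]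
  mu_pos _ := one_pos

theorem rareCommon_r_nonneg {d : ℝ} (hd : 0 < d) :
    ∀ i j, 0 ≤ (rareCommon d hd).r i j := by
  change ∀ i j : Bool, (0 : ℝ) ≤ if i then (if j then 1 / d else 1) else 0
  intro i j
  split_ifs <;> positivity

theorem longRunValue_rareCommon_le {d : ℝ} (hd : 0 < d) (π : (rareCommon d hd).OnlinePolicy) :
    π.longRunValue ≤ d := by
  have h := π.longRunValue_le (i := true) zero_le_one (rareCommon_r_nonneg hd) ?_ ?_ ?_
  · simpa [rareCommon] using h
  · change ∀ i j : Bool, i ≠ true → (if i then (if j then 1 / d else 1) else 0) = (0 : ℝ)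
    intro i j hi
    rw [if_neg hi]
  · change ∀ j : Bool, j ≠ true → (if true then (if j then 1 / d else 1) else 0) ≤ (1 : ℝ)
    intro j hj
    simp [hj]
  -- The condition holds with equality: the value `1 / d` of a pair exactly offsets the arrival rate
  -- `d`.
  · simp [rareCommon, hd.ne']

/-- Per rare arrival, rare pairs earn at least `(1 - d) ^ 2` and mixed pairs at least `1 - 3 * d - d
^ 2`, together `2 - 5 * d`. The constant `7` leaves room for the strict inequality required by
`le_off`. -/
theorem le_off_rareCommon {d : ℝ} (hd : 0 < d) (hd1 : d ≤ 1) :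
    d * (2 - 7 * d) ≤ (rareCommon d hd).off := by
  refine le_off (i := true) (j := false) (R := 1 / d) Bool.noConfusion
    (rareCommon_r_nonneg hd) ?_ ?_
  · change ∀ i j : Bool, (if i then (if j then 1 / d else 1) else 0) ≤ 1 / d
    have : 1 ≤ 1 / d := by rw [le_div_iff₀ hd]; linarith
    intro i j
    split_ifs
    · exact le_rfl
    · exact this
    · positivity
  · have h : (rareCommon d hd).localRate true false =
        d * (1 / d * (d / (d + 1) - (d / (d + 1)) ^ 2) +
          1 * (1 - 2 * (d / (d + 1)) - d / (d + 1 / d) - 1 / (1 + 1 / d))) := by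
      simp [localRate, rareCommon]
    rw [h]
    refine mul_lt_mul_of_pos_left ?_ hd
    have h1 : 1 / d * (d / (d + 1) - (d / (d + 1)) ^ 2) = (1 / (d + 1)) ^ 2 := by
      field_simp
      ring
    have h2 : 1 - d ≤ 1 / (d + 1) := by
      rw [le_div_iff₀ (by linarith)]
      nlinarith
    have h3 : (1 - d) ^ 2 ≤ (1 / (d + 1)) ^ 2 := pow_le_pow_left₀ (by linarith) h2 2
    have h4 : d / (d + 1) ≤ d := div_le_self hd.le (by linarith)
    have h5 : d / (d + 1 / d) ≤ d ^ 2 := by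
      rw [div_le_iff₀ (by positivity), mul_add, pow_two, mul_assoc d d (1 / d),
        mul_one_div_cancel hd.ne']
      nlinarith [pow_pos hd 3]
    have h6 : 1 / (1 + 1 / d) ≤ d := by
      rw [div_le_iff₀ (by positivity), mul_add, mul_one_div_cancel hd.ne']
      linarith
    rw [h1]
    nlinarith

end MatchingInstance

end

/-! ### Conclusion: choice of the parameter -/

open MatchingInstance in
theorem theorem2 (ε : ℝ) (hε : 0 < ε) :
    ∃ I : MatchingInstance,
      Fintype.card I.T = 2 ∧ (∀ i j, I.mu i = I.mu j) ∧ I.HomogeneousDepartures ∧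
        ∀ π : I.OnlinePolicy, π.IsMarkovian →
          π.longRunValue < (1 / 2 + ε) * I.off := by
  -- The goal `1 < (1 / 2 + ε) * (2 - 7 * d)` amounts to `d * (7 / 2 + 7 * ε) < 2 * ε`, and this `d`
  -- satisfies `d * (4 + 7 * ε) = ε`.
  have hd : 0 < ε / (4 + 7 * ε) := by positivity
  have hd1 : ε / (4 + 7 * ε) ≤ 1 := by
    rw [div_le_one (by positivity)]
    linarith
  have hde : ε / (4 + 7 * ε) * (4 + 7 * ε) = ε := div_mul_cancel₀ _ (by positivity)
  refine ⟨rareCommon _ hd, rfl, fun _ _ => rfl, Or.inl fun _ _ => rfl, fun π _ => ?_⟩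
  have h1 := longRunValue_rareCommon_le hd π
  have h2 := le_off_rareCommon hd hd1
  set d := ε / (4 + 7 * ε)
  refine h1.trans_lt (lt_of_lt_of_le ?_ (mul_le_mul_of_nonneg_left h2 (by positivity)))
  nlinarith
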